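/- Let $T^2=\mathbb{R}^2/\mathbb{Z}^2$ be the torus, let $\mathcal T$ be a triangulation of $T^2$ with a single vertex, and let $\tilde{\mathcal T}$ be its lift to the universal cover $\mathbb{R}^2$, on which $\pi_1(T^2)=\mathbb{Z}^2$ acts by deck transformations; fix a lift $v_0$ of the vertex. Let $O$ be a left order (a translation-invariant total order $<$) on $\mathbb{Z}^2$. Call an action $\rho$ of $\mathbb{Z}^2$ on $\mathbb{R}$ by homeomorphisms *allowed for $O$* if $\rho(g)(0)<\rho(h)(0)\iff g<h$. An action $\rho$ determines a function $F:\mathbb{R}^2\to\mathbb{R}$ as follows. At vertices, $F(gv_0)=\rho(g)(0)$. On an edge of $\tilde{\mathcal T}$ whose endpoint with the larger value of $F$ is $v_0$, $F$ is linear; on an edge whose endpoint with the larger value is $gv_0$, $F(x)=\rho(g)(F(g^{-1}x))$. On each triangle, $F$ is extended so that each level set in the triangle is the convex hull of the points of that level on the boundary of the triangle (linearity and convexity refer to the PL structure given by $\tilde{\mathcal T}$). The images in $T^2$ of the connected components of the level sets of $F$ are the leaves of a singular foliation $\mathcal F(\mathcal T,\rho)$. A leaf is *closed* if it is a simple closed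 curve (homeomorphic to a circle). The fLOiation $F_O$ of $O$ is $\mathcal F(\mathcal T,\rho_{i_0})$, where, for an enumeration $\mathbb{Z}^2=\{s_0,s_1,\dots\}$ with $s_0=0$, the minimal embedding $i_0:\mathbb{Z}^2\to\mathbb{R}$ is defined inductively by $i_0(s_0)=0$; $i_0(s_n)=\max_{p<n}i_0(s_p)+1$ if $s_n$ is larger than all $s_p$, $p<n$; $i_0(s_n)=\min_{p<n}i_0(s_p)-1$ if it is smaller than all of them; and otherwise $i_0(s_n)$ is the midpoint of the values of $i_0$ at the two closest neighbours of $s_n$ among $s_0,\dots,s_{n-1}$. The action $\rho_{i_0}$ is given by $\rho_{i_0}(g)(i_0(h))=i_0(g+h)$ on the image of $i_0$, extended continuously to the closure of the image and linearly to the complementary intervals. Then, for every choice of $\mathcal T$ and of the enumeration, $F_O$ has a closed leaf if and only if $O$ is not Archimedean. The same equivalence holds for $\mathcal F(\mathcal T,\rho)$ for every action $\rho$ that is allowed for $O$. -/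

import Mathlib

/-- The group `ℤ²` of deck transformations of the universal cover of the torus, i.e. `π₁(T²)`.
It is a type of its own, so that it carries no preferred order. -/
def Deck : Type := ℤ × ℤ

instance Deck.instAddCommGroup : AddCommGroup Deck := inferInstanceAs (AddCommGroup (ℤ × ℤ))

namespace FLOiation

/-- The universal cover of the torus. -/
abbrev Plane : Type := ℝ × ℝ

/-- The torus `S¹ × S¹ = ℝ² / ℤ²`. -/
abbrev Torus : Type := UnitAddCircle × UnitAddCircle

/-- The universal covering map. -/
def cover (x : Plane) : Torus := ((x.1 : UnitAddCircle), (x.2 : UnitAddCircle))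

/-- The lattice point `g · 0`; the deck transformation `g` is the translation by it. -/
def pt (g : Deck) : Plane := ((g.1 : ℝ), (g.2 : ℝ))

/-- A triangulation of the torus with a single vertex, given by its lift to the universal cover:
a `ℤ²`-invariant simplicial complex with underlying space `ℝ²` whose vertices form the single
orbit `ℤ²`, together with a homeomorphism, commuting with the deck transformations, that maps the
straight simplices of the complex onto the actual (possibly curved) simplices of the lifted
triangulation. -/
structure OneVertexTriangulation where
  complex : Geometry.SimplicialComplex ℝ Plane
  vertices_eq : complex.vertices = Set.range pt
  space_eq : complex.space = Set.univ
  invariant : ∀ (g : Deck), ∀ s ∈ complex.faces,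
    s.map (Equiv.addRight (pt g)).toEmbedding ∈ complex.faces
  chart : Plane ≃ₜ Plane
  chart_equivariant : ∀ (g : Deck) (x : Plane), chart (x + pt g) = chart x + pt g

/-- `p` and `q` are the endpoints of an edge of the lifted triangulation. -/
def OneVertexTriangulation.IsEdge (T : OneVertexTriangulation) (p q : Deck) : Prop :=
  ∃ e ∈ T.complex.faces, (e : Set Plane) = {pt p, pt q}

/-- `t` is the vertex set of a (closed) triangle of the lifted triangulation. -/
def OneVertexTriangulation.IsTriangle (T : OneVertexTriangulation) (t : Finset Plane) : Prop :=
  t ∈ T.complex.faces ∧ t.card = 3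

/-! ### From an order to an action on the line -/

section Action

variable [LinearOrder Deck]

/-- The minimal embedding of the totally ordered set `{s 0, s 1, …}` into `ℝ`, as a function of
the index. The first term has value `0`; a new maximum (minimum) is put at distance `1` above
(below) all previous values; every other term is put at the midpoint between the values of its
closest predecessors in the list from below and from above. -/
noncomputable def minimalValue (s : ℕ → Deck) (n : ℕ) : ℝ :=
  let below : Set ℝ := {x | ∃ p : Fin n, s p < s n ∧ x = minimalValue s p}
  let above : Set ℝ := {x | ∃ p : Fin n, s n < s p ∧ x = minimalValue s p}
  open Classical in
  if n = 0 then 0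
  else if above = ∅ then sSup below + 1
  else if below = ∅ then sInf above - 1
  else (sSup below + sInf above) / 2
termination_by n
decreasing_by all_goals exact p.2

/-- The minimal embedding `i₀ : ℤ² → ℝ` determined by an enumeration `s` of `ℤ²`. -/
noncomputable def minimalEmbedding (s : ℕ ≃ Deck) (g : Deck) : ℝ :=
  minimalValue s (s.symm g)

/-- The action `ρ_i` on `ℝ` obtained from `i : ℤ² → ℝ`: on the image of `i` it is
`i h ↦ i (g + h)`, and it is extended continuously to the closure of the image, and linearly to
the complementary intervals. Here `a` and `b` are the points of the closure of the image next to
`t` from below and from above (equal to `t` if `t` lies in the closure), and `a'` and `b'` are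
the points to which `g` sends them. -/
noncomputable def extendedAction (i : Deck → ℝ) (g : Deck) (t : ℝ) : ℝ :=
  let a := sSup {x | ∃ h, i h ≤ t ∧ x = i h}
  let b := sInf {x | ∃ h, t ≤ i h ∧ x = i h}
  let a' := sSup {x | ∃ h, i h ≤ t ∧ x = i (g + h)}
  let b' := sInf {x | ∃ h, t ≤ i h ∧ x = i (g + h)}
  open Classical in
  if a = b then a' else a' + (t - a) / (b - a) * (b' - a')

/-- `ρ` is an allowed action of `ℤ²` on the line inducing the given order: an action by
homeomorphisms for which `g ↦ ρ(g)(0)` is injective and order preserving. -/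
structure IsAllowedAction (ρ : Deck → ℝ → ℝ) : Prop where
  map_zero : ∀ t, ρ 0 t = t
  map_add : ∀ g h t, ρ (g + h) t = ρ g (ρ h t)
  continuous : ∀ g, Continuous (ρ g)
  orbit_lt_iff : ∀ g h, ρ g 0 < ρ h 0 ↔ g < h

/-! ### The singular foliation of an action -/

/-- The points of the 1-skeleton at which the defining function `F` has the value `c`.
On an edge from `p` to `q` with `p < q`, `F` is defined by `F x = ρ(q) (F (x - q))`, where on the
translated edge, which ends at the base vertex `0`, `F` is linear from `F (p - q) = ρ(p - q)(0)`
to `F 0 = 0`. In particular, `F` has the value `ρ(g)(0)` at the vertex `g`. -/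
def skeletonLevel (T : OneVertexTriangulation) (ρ : Deck → ℝ → ℝ) (c : ℝ) : Set Plane :=
  {x | ∃ p q : Deck, p < q ∧ T.IsEdge p q ∧ ∃ u ∈ Set.Icc (0 : ℝ) 1,
    x = AffineMap.lineMap (pt p) (pt q) u ∧ c = ρ q ((1 - u) * ρ (p - q) 0)}

/-- The defining function `F : ℝ² → ℝ` (in the straight coordinates of the triangulation). It is
extended from the 1-skeleton to each triangle in such a way that its level sets in the triangle
are the polytopes whose vertices are the points of that level on the boundary of the triangle:
`F x` is the value `c` for which `x` lies in the convex hull of the points of level `c` on the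
boundary of a triangle containing `x`. -/
noncomputable def definingFunction (T : OneVertexTriangulation) (ρ : Deck → ℝ → ℝ)
    (x : Plane) : ℝ :=
  Classical.epsilon fun c : ℝ => ∃ t : Finset Plane, T.IsTriangle t ∧
    x ∈ convexHull ℝ (skeletonLevel T ρ c ∩ convexHull ℝ (t : Set Plane))

/-- The leaves on the torus of the singular foliation `F(T, ρ)`: the images under the covering map
of the connected components of the level sets of the defining function. -/
def IsLeaf (T : OneVertexTriangulation) (ρ : Deck → ℝ → ℝ) (L : Set Torus) : Prop :=
  ∃ x : Plane, L = (fun y => cover (T.chart y)) ''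
    connectedComponentIn {y | definingFunction T ρ y = definingFunction T ρ x} x

/-- The foliation `F(T, ρ)` has a closed leaf, i.e. a leaf which is a simple closed curve. -/
def HasClosedLeaf (T : OneVertexTriangulation) (ρ : Deck → ℝ → ℝ) : Prop :=
  ∃ L : Set Torus, IsLeaf T ρ L ∧ Nonempty (L ≃ₜ Circle)

end Action

end FLOiation

set_option linter.unusedSectionVars false

namespace FLOiation

/-! ### The minimal embedding: monotonicity, unboundedness, absence of gaps at non-adjacent cuts. -/

section MinimalEmbedding

open Set

variable [LinearOrder Deck]

/-! Fix an allowed action `ρ` with defining function `F`. A one-vertex triangulation consists of the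
translates of two triangles `0, a, a + b` and `0, b, a + b`, where `a` and `b` are positive
generators of the group (`OneVertexTriangulation.exists_isGeneratedBy`). In both, the edge from the
lowest to the highest vertex is `a + b`, and in every triangle `F` increases strictly in this
direction (`IsOrderedTriangle.definingFunction_lt`). Hence, in the coordinates `w • a + z • (a +
b)`, each level set lying between two orbit values is the graph of a continuous function of `w`
(`IsGeneratedBy.exists_level_graph`). It is connected, so every leaf is the image of a line in the
torus.

Since `F (x + g) = ρ g (F x)`, two points of the level `c` have the same image exactly when they
differ by some `g` that fixes `c` (`IsGeneratedBy.leaf_eq_leaf_iff`). If the stabiliser of `c` is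
trivial, the leaf is a continuous injective image of the line, and no continuous bijection from the
line to a circle exists (`not_bijective_circle`). If it is nontrivial, the parametrisation is
periodic and the leaf is an embedded circle.

It remains to decide whether a level between orbit points can have a stabiliser. A nonzero `k`
fixing it would have all its multiples bounded, which an Archimedean order excludes. Conversely, if
`n • k < x` for all `n` with `k` positive, the supremum of the `ρ (n • k) 0` is fixed by `k`.

For the foliation of the order itself one only has to see that the extended action is allowed. The
midpoint rule leaves gaps in the image of the minimal embedding only between adjacent elements
(`exists_minimalEmbedding_sub_lt`). Translations carry such gaps to such gaps and limit points to
limit points, so the piecewise linear extension is a monotone action. -/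

lemma minimalValue_add_one_le {s : ℕ → Deck} {n : ℕ} (h : ∀ p < n, s p < s n) {p : ℕ}
    (hp : p < n) : minimalValue s p + 1 ≤ minimalValue s n := by
  have hn : n ≠ 0 := by omega
  rw [minimalValue.eq_1 s n]
  have hab : {x : ℝ | ∃ p : Fin n, s n < s p ∧ x = minimalValue s p} = ∅ := by
    ext x
    simp only [mem_ofPred_eq, mem_empty_iff_false, iff_false, not_exists, not_and]
    intro q hq
    exact absurd hq (h q q.2).not_gt
  simp only [hn, if_false, hab, if_true]
  gcongr
  refine le_csSup (Set.Finite.bddAbove ?_) ⟨⟨p, hp⟩, h p hp, rfl⟩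
  refine (Set.finite_range fun q : Fin n => minimalValue s q).subset ?_
  rintro x ⟨q, -, rfl⟩
  exact ⟨q, rfl⟩

lemma minimalValue_le_sub_one {s : ℕ → Deck} {n : ℕ} (h : ∀ p < n, s n < s p) {p : ℕ}
    (hp : p < n) : minimalValue s n ≤ minimalValue s p - 1 := by
  have hn : n ≠ 0 := by omega
  rw [minimalValue.eq_1 s n]
  have hab : {x : ℝ | ∃ p : Fin n, s n < s p ∧ x = minimalValue s p} ≠ ∅ :=
    Set.Nonempty.ne_empty ⟨_, ⟨p, hp⟩, h p hp, rfl⟩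
  have hbe : {x : ℝ | ∃ p : Fin n, s p < s n ∧ x = minimalValue s p} = ∅ := by
    ext x
    simp only [mem_ofPred_eq, mem_empty_iff_false, iff_false, not_exists, not_and]
    intro q hq
    exact absurd hq (h q q.2).not_gt
  simp only [hn, if_false, hab, hbe, if_true]
  gcongr
  refine csInf_le (Set.Finite.bddBelow ?_) ⟨⟨p, hp⟩, h p hp, rfl⟩
  refine (Set.finite_range fun q : Fin n => minimalValue s q).subset ?_
  rintro x ⟨q, -, rfl⟩
  exact ⟨q, rfl⟩

/-- Monotonicity is assumed for the indices below `n` only, so that the lemma is available inside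
the induction that proves monotonicity. -/
lemma minimalValue_eq_midpoint {s : ℕ → Deck} {n p q : ℕ}
    (hmono : ∀ i < n, ∀ j < n, s i ≤ s j → minimalValue s i ≤ minimalValue s j)
    (hp : p < n) (hq : q < n) (hpn : s p < s n) (hnq : s n < s q)
    (h : ∀ r < n, s r ≤ s p ∨ s q ≤ s r) :
    minimalValue s n = (minimalValue s p + minimalValue s q) / 2 := by
  have hn : n ≠ 0 := by omega
  rw [minimalValue.eq_1 s n]
  have hab : {x : ℝ | ∃ p : Fin n, s n < s p ∧ x = minimalValue s p} ≠ ∅ :=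
    Set.Nonempty.ne_empty ⟨_, ⟨q, hq⟩, hnq, rfl⟩
  have hbe : {x : ℝ | ∃ p : Fin n, s p < s n ∧ x = minimalValue s p} ≠ ∅ :=
    Set.Nonempty.ne_empty ⟨_, ⟨p, hp⟩, hpn, rfl⟩
  have h1 : IsGreatest {x : ℝ | ∃ p : Fin n, s p < s n ∧ x = minimalValue s p}
      (minimalValue s p) := by
    refine ⟨⟨⟨p, hp⟩, hpn, rfl⟩, ?_⟩
    rintro x ⟨r, hr, rfl⟩
    rcases h r r.2 with h | h
    · exact hmono r r.2 p hp h
    · exact absurd (hr.trans hnq) h.not_gt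
  have h2 : IsLeast {x : ℝ | ∃ p : Fin n, s n < s p ∧ x = minimalValue s p}
      (minimalValue s q) := by
    refine ⟨⟨⟨q, hq⟩, hnq, rfl⟩, ?_⟩
    rintro x ⟨r, hr, rfl⟩
    rcases h r r.2 with h | h
    · exact absurd (hpn.trans hr) h.not_gt
    · exact hmono q hq r r.2 h
  simp only [hn, if_false, hab, hbe, h1.csSup_eq, h2.csInf_eq]

/-- Induction on the length of the list: a new extreme term is moved by `1` past all values, and any
other term is the midpoint of its two neighbours, whose values are distinct by induction. -/
lemma minimalValue_lt {s : ℕ → Deck} (hs : Function.Injective s) (n : ℕ) :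
    ∀ p < n, ∀ q < n, s p < s q → minimalValue s p < minimalValue s q := by
  induction n with
  | zero => intro p hp; omega
  | succ n ih =>
    have hle : ∀ i < n, ∀ j < n, s i ≤ s j → minimalValue s i ≤ minimalValue s j := by
      intro i hi j hj hij
      rcases hij.eq_or_lt with h | h
      · rw [hs h]
      · exact (ih i hi j hj h).le
    have key : ∀ p < n, (s p < s n → minimalValue s p < minimalValue s n) ∧
        (s n < s p → minimalValue s n < minimalValue s p) := by
      intro p hp
      by_cases hmax : ∀ r < n, s r < s n
      · exact ⟨fun _ => by linarith [minimalValue_add_one_le hmax hp],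
          fun h => absurd h (hmax p hp).not_gt⟩
      by_cases hmin : ∀ r < n, s n < s r
      · exact ⟨fun h => absurd h (hmin p hp).not_gt,
          fun _ => by linarith [minimalValue_le_sub_one hmin hp]⟩
      push Not at hmax hmin
      obtain ⟨r₁, hr₁, hr₁'⟩ := hmax
      obtain ⟨r₂, hr₂, hr₂'⟩ := hmin
      have hne : ∀ r < n, s r ≠ s n := fun r hr h => by have := hs h; omega
      obtain ⟨q, hq, hqmin⟩ := Finset.exists_min_image
        ((Finset.range n).filter fun r => s n < s r) s
        ⟨r₁, by simpa using ⟨hr₁, lt_of_le_of_ne hr₁' (hne r₁ hr₁).symm⟩⟩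
      obtain ⟨t, ht, htmax⟩ := Finset.exists_max_image
        ((Finset.range n).filter fun r => s r < s n) s
        ⟨r₂, by simpa using ⟨hr₂, lt_of_le_of_ne hr₂' (hne r₂ hr₂)⟩⟩
      simp only [Finset.mem_filter, Finset.mem_range, and_imp] at hq ht hqmin htmax
      have hmid := minimalValue_eq_midpoint hle ht.1 hq.1 ht.2 hq.2 (fun r hr => by
        rcases lt_or_gt_of_ne (hne r hr) with h | h
        · exact Or.inl (htmax r hr h)
        · exact Or.inr (hqmin r hr h))
      have htq := ih t ht.1 q hq.1 (ht.2.trans hq.2)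
      constructor
      · intro h
        have := hle p hp t ht.1 (htmax p hp h)
        linarith
      · intro h
        have := hle q hq.1 p hp (hqmin p hp h)
        linarith
    intro p hp q hq hpq
    rcases Nat.lt_succ_iff_lt_or_eq.1 hp with hp | rfl <;>
      rcases Nat.lt_succ_iff_lt_or_eq.1 hq with hq | rfl
    · exact ih p hp q hq hpq
    · exact (key p hp).1 hpq
    · exact (key q hq).2 hpq
    · exact absurd hpq (lt_irrefl _)

lemma minimalEmbedding_strictMono (s : ℕ ≃ Deck) : StrictMono (minimalEmbedding s) := by
  intro g h hgh
  refine minimalValue_lt s.injective (max (s.symm g) (s.symm h) + 1) _ ?_ _ ?_ ?_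
  · omega
  · omega
  · simpa using hgh

lemma minimalEmbedding_zero (s : ℕ ≃ Deck) (hs : s 0 = 0) : minimalEmbedding s 0 = 0 := by
  have : s.symm 0 = 0 := by rw [← hs]; simp
  rw [minimalEmbedding, this, minimalValue]
  simp

lemma minimalEmbedding_apply (s : ℕ ≃ Deck) (n : ℕ) :
    minimalEmbedding s (s n) = minimalValue s n := by simp [minimalEmbedding]

/-- If the image were bounded, some value would be within `1` of the supremum; the next record
maximum of the enumeration lies at least `1` above it. -/
lemma minimalEmbedding_unbounded_above [NoMaxOrder Deck] (s : ℕ ≃ Deck) (B : ℝ) :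
    ∃ g, B < minimalEmbedding s g := by
  classical
  by_contra! hB
  have hbdd : BddAbove (range (minimalEmbedding s)) := ⟨B, by rintro _ ⟨g, rfl⟩; exact hB g⟩
  obtain ⟨_, ⟨g, rfl⟩, hg⟩ := exists_lt_of_lt_csSup (range_nonempty (minimalEmbedding s))
    (sub_one_lt (sSup (range (minimalEmbedding s))))
  -- `s k` is the largest term up to `g`. The first term above `s k` is then larger than all of its
  -- predecessors.
  obtain ⟨k, hk, hkmax⟩ := Finset.exists_max_image (Finset.range (s.symm g + 1)) s ⟨0, by simp⟩
  have hgk : g ≤ s k := by simpa using hkmax (s.symm g) (by simp)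
  have hex : ∃ n, s k < s n := by
    obtain ⟨h, hh⟩ := exists_gt (s k)
    exact ⟨s.symm h, by simpa using hh⟩
  have hlt := Nat.find_spec hex
  have hmin : ∀ p < Nat.find hex, s p ≤ s k := fun p hp => not_lt.1 (Nat.find_min hex hp)
  have hkn : k < Nat.find hex := by
    by_contra! h
    have := hkmax (Nat.find hex) (by simp only [Finset.mem_range] at hk ⊢; omega)
    exact absurd hlt this.not_gt
  have h1 := minimalValue_add_one_le (s := s) (fun p hp => (hmin p hp).trans_lt hlt) hkn
  have h2 := (minimalEmbedding_strictMono s).monotone hgk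
  have h3 := le_csSup hbdd ⟨s (Nat.find hex), rfl⟩
  rw [minimalEmbedding_apply] at h2 h3
  linarith

lemma minimalEmbedding_unbounded_below [NoMinOrder Deck] (s : ℕ ≃ Deck) (B : ℝ) :
    ∃ g, minimalEmbedding s g < B := by
  classical
  by_contra! hB
  have hbdd : BddBelow (range (minimalEmbedding s)) := ⟨B, by rintro _ ⟨g, rfl⟩; exact hB g⟩
  obtain ⟨_, ⟨g, rfl⟩, hg⟩ := exists_lt_of_csInf_lt (range_nonempty (minimalEmbedding s))
    (lt_add_one (sInf (range (minimalEmbedding s))))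
  obtain ⟨k, hk, hkmin⟩ := Finset.exists_min_image (Finset.range (s.symm g + 1)) s ⟨0, by simp⟩
  have hgk : s k ≤ g := by simpa using hkmin (s.symm g) (by simp)
  have hex : ∃ n, s n < s k := by
    obtain ⟨h, hh⟩ := exists_lt (s k)
    exact ⟨s.symm h, by simpa using hh⟩
  have hlt := Nat.find_spec hex
  have hmin : ∀ p < Nat.find hex, s k ≤ s p := fun p hp => not_lt.1 (Nat.find_min hex hp)
  have hkn : k < Nat.find hex := by
    by_contra! h
    have := hkmin (Nat.find hex) (by simp only [Finset.mem_range] at hk ⊢; omega)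
    exact absurd hlt this.not_gt
  have h1 := minimalValue_le_sub_one (s := s) (fun p hp => hlt.trans_le (hmin p hp)) hkn
  have h2 := (minimalEmbedding_strictMono s).monotone hgk
  have h3 := csInf_le hbdd ⟨s (Nat.find hex), rfl⟩
  rw [minimalEmbedding_apply] at h2 h3
  linarith

/-- The first term of the enumeration inserted between two elements that are adjacent among their
predecessors is placed at the midpoint. -/
lemma exists_minimalEmbedding_eq_midpoint (s : ℕ ≃ Deck) {N : ℕ} {a b : Deck}
    (ha : s.symm a < N) (hb : s.symm b < N) (hadj : ∀ p < N, s p ≤ a ∨ b ≤ s p)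
    (hex : ∃ g, a < g ∧ g < b) :
    ∃ g, a < g ∧ g < b ∧
      minimalEmbedding s g = (minimalEmbedding s a + minimalEmbedding s b) / 2 := by
  classical
  have hex' : ∃ n, a < s n ∧ s n < b := by
    obtain ⟨g, hg⟩ := hex
    exact ⟨s.symm g, by simpa using hg⟩
  obtain ⟨h1, h2⟩ := Nat.find_spec hex'
  have hmin : ∀ p < Nat.find hex', s p ≤ a ∨ b ≤ s p := by
    intro p hp
    have := Nat.find_min hex' hp
    by_contra! h
    exact this h
  -- No term before `N` lies strictly between `a` and `b`, so both occur before the first term that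
  -- does.
  have hN : N ≤ Nat.find hex' := by
    by_contra! h
    rcases hadj _ h with h | h
    · exact absurd h1 h.not_gt
    · exact absurd h2 h.not_gt
  refine ⟨s (Nat.find hex'), h1, h2, ?_⟩
  rw [minimalEmbedding_apply, minimalEmbedding, minimalEmbedding]
  refine minimalValue_eq_midpoint (fun i _ j _ hij => ?_) (by omega) (by omega)
    (by simpa using h1) (by simpa using h2) (by simpa using hmin)
  simpa [minimalEmbedding_apply] using (minimalEmbedding_strictMono s).monotone hij

/-- The minimal embedding leaves no gap at a cut, except between two adjacent elements. -/
lemma exists_minimalEmbedding_sub_lt (s : ℕ ≃ Deck) {A : Set Deck}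
    (hA : A.Nonempty) (hAc : Aᶜ.Nonempty)
    (hgap : ¬ ∃ a ∈ A, ∃ b ∉ A, ∀ g, g ≤ a ∨ b ≤ g) {ε : ℝ} (hε : 0 < ε) :
    ∃ a ∈ A, ∃ b ∉ A, minimalEmbedding s b - minimalEmbedding s a < ε := by
  classical
  by_contra! hcon
  obtain ⟨a₀, ha₀⟩ := hA
  obtain ⟨b₀, hb₀⟩ := hAc
  set D : Set ℝ := {x | ∃ a ∈ A, ∃ b ∉ A, x = minimalEmbedding s b - minimalEmbedding s a} with hD
  have hDb : BddBelow D := ⟨ε, by rintro x ⟨a, ha, b, hb, rfl⟩; exact hcon a ha b hb⟩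
  have hDn : D.Nonempty := ⟨_, a₀, ha₀, b₀, hb₀, rfl⟩
  have hpos : 0 < sInf D := lt_of_lt_of_le hε
    (le_csInf hDn (by rintro x ⟨a, ha, b, hb, rfl⟩; exact hcon a ha b hb))
  -- Choose a pair across the cut whose difference is less than twice the infimum. Inserting a
  -- midpoint will halve the difference and bring it below the infimum.
  obtain ⟨_, ⟨a, ha, b, hb, rfl⟩, hab⟩ := exists_lt_of_csInf_lt hDn
    (show sInf D < 2 * sInf D by linarith)
  set N := max (s.symm a) (s.symm b) + 1 with hN
  obtain ⟨i, hi, himax⟩ := Finset.exists_max_image ((Finset.range N).filter fun r => s r ∈ A) s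
    ⟨s.symm a, by simp only [Finset.mem_filter, Finset.mem_range, Equiv.apply_symm_apply]
                  exact ⟨by omega, ha⟩⟩
  obtain ⟨j, hj, hjmin⟩ := Finset.exists_min_image ((Finset.range N).filter fun r => s r ∉ A) s
    ⟨s.symm b, by simp only [Finset.mem_filter, Finset.mem_range, Equiv.apply_symm_apply]
                  exact ⟨by omega, hb⟩⟩
  simp only [Finset.mem_filter, Finset.mem_range, and_imp] at hi hj himax hjmin
  have hai : a ≤ s i := by simpa using himax (s.symm a) (by omega) (by simpa using ha)
  have hbj : s j ≤ b := by simpa using hjmin (s.symm b) (by omega) (by simpa using hb)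
  have hm := (minimalEmbedding_strictMono s).monotone
  have h1 := hm hai
  have h2 := hm hbj
  obtain ⟨g, hg1, hg2, hg⟩ := exists_minimalEmbedding_eq_midpoint s (N := N) (a := s i) (b := s j)
    (by simpa using hi.1) (by simpa using hj.1)
    (fun p hp => by
      by_cases h : s p ∈ A
      · exact Or.inl (himax p hp h)
      · exact Or.inr (hjmin p hp h))
    (by
      -- `hgap` also places `A` below its complement: if `s j ≤ s i`, every `g` would satisfy `g ≤ s
      -- i` or `s j ≤ g`.
      by_contra! h
      refine hgap ⟨s i, hi.2, s j, hj.2, fun g => ?_⟩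
      by_cases hg : s i < g
      · exact Or.inr (h g hg)
      · exact Or.inl (not_lt.1 hg))
  by_cases hgA : g ∈ A
  · have := csInf_le hDb ⟨g, hgA, s j, hj.2, rfl⟩
    linarith
  · have := csInf_le hDb ⟨s i, hi.2, g, hgA, rfl⟩
    linarith

end MinimalEmbedding

/-! ### Extension of the translation action from the image of an embedding to the line. -/

section ExtendedAction

open Set

variable [LinearOrder Deck]

/-- The properties of the minimal embedding that make its translation action extend to `ℝ`. -/
structure IsTightEmbedding (i : Deck → ℝ) : Prop where
  strictMono : StrictMono i
  unbounded_above : ∀ B, ∃ g, B < i g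
  unbounded_below : ∀ B, ∃ g, i g < B
  exists_sub_lt : ∀ A : Set Deck, A.Nonempty → Aᶜ.Nonempty →
    (¬ ∃ a ∈ A, ∃ b ∉ A, ∀ g, g ≤ a ∨ b ≤ g) → ∀ ε > 0, ∃ a ∈ A, ∃ b ∉ A, i b - i a < ε

variable [IsOrderedAddMonoid Deck] {i : Deck → ℝ}

namespace IsTightEmbedding

/-- The value is a convex combination of `a'` and `b'`. These two bounds are all that is needed at
points outside the gaps, where they pin the value down. -/
lemma extendedAction_mem (hi : IsTightEmbedding i) (g : Deck) (t : ℝ) :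
    (∀ h, i h ≤ t → i (g + h) ≤ extendedAction i g t) ∧
      ∀ h, t ≤ i h → extendedAction i g t ≤ i (g + h) := by
  obtain ⟨k₀, hk₀⟩ := hi.unbounded_below t
  obtain ⟨k₁, hk₁⟩ := hi.unbounded_above t
  have hcmp : ∀ h h', i h ≤ t → t ≤ i h' → i (g + h) ≤ i (g + h') := fun h h' h1 h2 =>
    hi.strictMono.monotone (add_le_add_right (hi.strictMono.le_iff_le.1 (h1.trans h2)) g)
  set a := sSup {x | ∃ h, i h ≤ t ∧ x = i h} with ha
  set b := sInf {x | ∃ h, t ≤ i h ∧ x = i h} with hb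
  set a' := sSup {x | ∃ h, i h ≤ t ∧ x = i (g + h)} with ha'
  set b' := sInf {x | ∃ h, t ≤ i h ∧ x = i (g + h)} with hb'
  have hat : a ≤ t := csSup_le ⟨_, k₀, hk₀.le, rfl⟩ (by rintro x ⟨h, hh, rfl⟩; exact hh)
  have htb : t ≤ b := le_csInf ⟨_, k₁, hk₁.le, rfl⟩ (by rintro x ⟨h, hh, rfl⟩; exact hh)
  have hle : ∀ h, i h ≤ t → i (g + h) ≤ a' := fun h hh => le_csSup
    ⟨i (g + k₁), by rintro x ⟨h', hh', rfl⟩; exact hcmp _ _ hh' hk₁.le⟩ ⟨h, hh, rfl⟩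
  have hge : ∀ h, t ≤ i h → b' ≤ i (g + h) := fun h hh => csInf_le
    ⟨i (g + k₀), by rintro x ⟨h', hh', rfl⟩; exact hcmp _ _ hk₀.le hh'⟩ ⟨h, hh, rfl⟩
  have hab' : a' ≤ b' := by
    refine csSup_le ⟨_, k₀, hk₀.le, rfl⟩ ?_
    rintro x ⟨h, hh, rfl⟩
    refine le_csInf ⟨_, k₁, hk₁.le, rfl⟩ ?_
    rintro x ⟨h', hh', rfl⟩
    exact hcmp _ _ hh hh'
  have hext : a' ≤ extendedAction i g t ∧ extendedAction i g t ≤ b' := by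
    rw [extendedAction]
    simp only [← ha, ← hb, ← ha', ← hb']
    split_ifs with h
    · exact ⟨le_rfl, hab'⟩
    · have hlt : 0 < b - a := sub_pos.2 (lt_of_le_of_ne (hat.trans htb) h)
      have h0 : 0 ≤ (t - a) / (b - a) := div_nonneg (by linarith) hlt.le
      have h1 : (t - a) / (b - a) ≤ 1 := (div_le_one hlt).2 (by linarith)
      constructor <;> nlinarith
  exact ⟨fun h hh => (hle h hh).trans hext.1, fun h hh => hext.2.trans (hge h hh)⟩

lemma extendedAction_apply (hi : IsTightEmbedding i) (g h : Deck) :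
    extendedAction i g (i h) = i (g + h) :=
  le_antisymm ((hi.extendedAction_mem g _).2 h le_rfl) ((hi.extendedAction_mem g _).1 h le_rfl)

lemma extendedAction_gap (hi : IsTightEmbedding i) (g : Deck) {h₀ h₁ : Deck}
    (hadj : ∀ k, k ≤ h₀ ∨ h₁ ≤ k) {t : ℝ} (h0 : i h₀ < t) (h1 : t < i h₁) :
    extendedAction i g t =
      i (g + h₀) + (t - i h₀) / (i h₁ - i h₀) * (i (g + h₁) - i (g + h₀)) := by
  have hlo : ∀ k, i k ≤ t → k ≤ h₀ := fun k hk => (hadj k).resolve_right fun h =>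
    absurd (hk.trans_lt h1) (hi.strictMono.monotone h).not_gt
  have hhi : ∀ k, t ≤ i k → h₁ ≤ k := fun k hk => (hadj k).resolve_left fun h =>
    absurd (h0.trans_le hk) (hi.strictMono.monotone h).not_gt
  have ha : IsGreatest {x | ∃ h, i h ≤ t ∧ x = i h} (i h₀) :=
    ⟨⟨h₀, h0.le, rfl⟩, by rintro x ⟨h, hh, rfl⟩; exact hi.strictMono.monotone (hlo h hh)⟩
  have hb : IsLeast {x | ∃ h, t ≤ i h ∧ x = i h} (i h₁) :=
    ⟨⟨h₁, h1.le, rfl⟩, by rintro x ⟨h, hh, rfl⟩; exact hi.strictMono.monotone (hhi h hh)⟩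
  have ha' : IsGreatest {x | ∃ h, i h ≤ t ∧ x = i (g + h)} (i (g + h₀)) :=
    ⟨⟨h₀, h0.le, rfl⟩, by
      rintro x ⟨h, hh, rfl⟩; exact hi.strictMono.monotone (add_le_add_right (hlo h hh) g)⟩
  have hb' : IsLeast {x | ∃ h, t ≤ i h ∧ x = i (g + h)} (i (g + h₁)) :=
    ⟨⟨h₁, h1.le, rfl⟩, by
      rintro x ⟨h, hh, rfl⟩; exact hi.strictMono.monotone (add_le_add_right (hhi h hh) g)⟩
  rw [extendedAction]
  simp only [ha.csSup_eq, hb.csInf_eq, ha'.csSup_eq, hb'.csInf_eq, (h0.trans h1).ne, if_false]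

/-- A real number is either in a gap between adjacent elements, or pinned down by the image, in
which case so are its images under all translations. -/
lemma gap_or_limit (hi : IsTightEmbedding i) (t : ℝ) :
    (∃ h₀ h₁, (∀ k, k ≤ h₀ ∨ h₁ ≤ k) ∧ i h₀ < t ∧ t < i h₁) ∨
      ∀ g, ∀ ε > 0, ∃ h h', i h ≤ t ∧ t ≤ i h' ∧ i (g + h') - i (g + h) < ε := by
  by_cases hgap : ∃ a, i a ≤ t ∧ ∃ b, t < i b ∧ ∀ g, g ≤ a ∨ b ≤ g
  · obtain ⟨a, ha, b, hb, hab⟩ := hgap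
    rcases ha.eq_or_lt with rfl | ha
    -- A point of the image counts as pinned down, with `h = h'`.
    · exact Or.inr fun g ε hε => ⟨a, a, le_rfl, le_rfl, by simpa using hε⟩
    · exact Or.inl ⟨a, b, hab, ha, hb⟩
  · refine Or.inr fun g ε hε => ?_
    obtain ⟨k₀, hk₀⟩ := hi.unbounded_below t
    obtain ⟨k₁, hk₁⟩ := hi.unbounded_above t
    -- Smallness is required after translation by `g`, so the cut at `t` is translated first; a gap
    -- at the translated cut would translate back to one at `t`.
    obtain ⟨a, ha, b, hb, hab⟩ := hi.exists_sub_lt {k | i (-g + k) ≤ t}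
      ⟨g + k₀, by simpa using hk₀.le⟩ ⟨g + k₁, by simpa using hk₁⟩ (by
        rintro ⟨a, ha, b, hb, hab⟩
        refine hgap ⟨-g + a, ha, -g + b, not_le.1 hb, fun k => ?_⟩
        rcases hab (g + k) with h | h
        · exact Or.inl (by simpa using add_le_add_right h (-g))
        · exact Or.inr (by simpa using add_le_add_right h (-g))) ε hε
    exact ⟨-g + a, -g + b, ha, (not_le.1 hb).le, by simpa using hab⟩

/-- An image point between `t` and `t'` separates the two values. Otherwise both lie in the same
gap, where the map is affine and increasing, or `t` is pinned down by the image. -/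
lemma extendedAction_monotone (hi : IsTightEmbedding i) (g : Deck) :
    Monotone (extendedAction i g) := by
  intro t t' htt
  rcases htt.eq_or_lt with rfl | htt
  · exact le_rfl
  by_cases hex : ∃ h, t ≤ i h ∧ i h ≤ t'
  · obtain ⟨h, h1, h2⟩ := hex
    exact ((hi.extendedAction_mem g t).2 h h1).trans ((hi.extendedAction_mem g t').1 h h2)
  push Not at hex
  rcases hi.gap_or_limit t with ⟨h₀, h₁, hadj, h0, h1⟩ | hlim
  · rw [hi.extendedAction_gap g hadj h0 h1,
      hi.extendedAction_gap g hadj (h0.trans htt) (hex _ h1.le)]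
    have hlt : i h₀ < i h₁ := h0.trans h1
    have : i (g + h₀) < i (g + h₁) :=
      hi.strictMono (add_lt_add_right (hi.strictMono.lt_iff_lt.1 hlt) g)
    gcongr
  · refine le_of_forall_pos_le_add fun ε hε => ?_
    obtain ⟨h, h', h1, h2, h3⟩ := hlim g ε hε
    have := (hi.extendedAction_mem g t).2 h' h2
    have := (hi.extendedAction_mem g t').1 h (h1.trans htt.le)
    linarith

lemma extendedAction_zero (hi : IsTightEmbedding i) (t : ℝ) : extendedAction i 0 t = t := by
  rcases hi.gap_or_limit t with ⟨h₀, h₁, hadj, h0, h1⟩ | hlim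
  · rw [hi.extendedAction_gap 0 hadj h0 h1, zero_add, zero_add, div_mul_cancel₀]
    · ring
    · linarith
  · obtain ⟨hl, hu⟩ := hi.extendedAction_mem 0 t
    refine eq_of_abs_sub_nonpos (le_of_forall_pos_le_add fun ε hε => ?_)
    obtain ⟨h, h', h1, h2, h3⟩ := hlim 0 ε hε
    have e1 := hl h h1
    have e2 := hu h' h2
    simp only [zero_add] at *
    rw [abs_le]
    constructor <;> linarith

/-- Translation by `h` carries a gap onto a gap and preserves the relative position in it, so the
affine formulas compose. At a pinned point both sides lie between the same arbitrarily close image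
values. -/
lemma extendedAction_add (hi : IsTightEmbedding i) (g h : Deck) (t : ℝ) :
    extendedAction i (g + h) t = extendedAction i g (extendedAction i h t) := by
  rcases hi.gap_or_limit t with ⟨h₀, h₁, hadj, h0, h1⟩ | hlim
  · have hlt : i h₀ < i h₁ := h0.trans h1
    have hlt' : i (h + h₀) < i (h + h₁) :=
      hi.strictMono (add_lt_add_right (hi.strictMono.lt_iff_lt.1 hlt) h)
    have hadj' : ∀ k, k ≤ h + h₀ ∨ h + h₁ ≤ k := fun k => by
      rcases hadj (-h + k) with h' | h'
      · exact Or.inl (by simpa using add_le_add_right h' h)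
      · exact Or.inr (by simpa using add_le_add_right h' h)
    have hpos : 0 < (t - i h₀) / (i h₁ - i h₀) := div_pos (by linarith) (by linarith)
    have hlt1 : (t - i h₀) / (i h₁ - i h₀) < 1 := (div_lt_one (by linarith)).2 (by linarith)
    rw [hi.extendedAction_gap (g + h) hadj h0 h1, hi.extendedAction_gap h hadj h0 h1,
      hi.extendedAction_gap g hadj' (by nlinarith) (by nlinarith), add_sub_cancel_left,
      mul_div_cancel_right₀ _ (by linarith), add_assoc, add_assoc]
  · obtain ⟨hl, hu⟩ := hi.extendedAction_mem (g + h) t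
    obtain ⟨hl', hu'⟩ := hi.extendedAction_mem g (extendedAction i h t)
    refine eq_of_abs_sub_nonpos (le_of_forall_pos_le_add fun ε hε => ?_)
    obtain ⟨k, k', h1, h2, h3⟩ := hlim (g + h) ε hε
    have e1 := hl k h1
    have e2 := hu k' h2
    have e3 := hl' (h + k) ((hi.extendedAction_mem h t).1 k h1)
    have e4 := hu' (h + k') ((hi.extendedAction_mem h t).2 k' h2)
    rw [← add_assoc] at e3 e4
    rw [abs_le]
    constructor <;> linarith

theorem isAllowedAction (hi : IsTightEmbedding i) (h0 : i 0 = 0) :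
    IsAllowedAction (extendedAction i) where
  map_zero := hi.extendedAction_zero
  map_add := hi.extendedAction_add
  -- A monotone surjection of the line is continuous; surjectivity comes from the action of `-g`.
  continuous g := (hi.extendedAction_monotone g).continuous_of_surjective fun t =>
    ⟨extendedAction i (-g) t, by
      rw [← hi.extendedAction_add, add_neg_cancel, hi.extendedAction_zero]⟩
  orbit_lt_iff g h := by
    rw [← h0, hi.extendedAction_apply, hi.extendedAction_apply, add_zero, add_zero,
      hi.strictMono.lt_iff_lt]

end IsTightEmbedding

instance : Nontrivial Deck := inferInstanceAs (Nontrivial (ℤ × ℤ))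

theorem isTightEmbedding_minimalEmbedding (s : ℕ ≃ Deck) :
    IsTightEmbedding (minimalEmbedding s) where
  strictMono := minimalEmbedding_strictMono s
  unbounded_above := minimalEmbedding_unbounded_above s
  unbounded_below := minimalEmbedding_unbounded_below s
  exists_sub_lt _ hA hAc hgap _ hε := exists_minimalEmbedding_sub_lt s hA hAc hgap hε

theorem isAllowedAction_extendedAction_minimalEmbedding (s : ℕ ≃ Deck) (hs : s 0 = 0) :
    IsAllowedAction (extendedAction (minimalEmbedding s)) :=
  (isTightEmbedding_minimalEmbedding s).isAllowedAction (minimalEmbedding_zero s hs)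

end ExtendedAction

/-! ### Levels on the edges of the triangulation. -/

section Edges

open Set

lemma pt_zero : pt 0 = 0 := by
  show (((0 : ℤ) : ℝ), ((0 : ℤ) : ℝ)) = 0
  simp

lemma pt_add (g h : Deck) : pt (g + h) = pt g + pt h := by
  show (((g.1 + h.1 : ℤ) : ℝ), ((g.2 + h.2 : ℤ) : ℝ)) = _
  simp [pt]

lemma pt_neg (g : Deck) : pt (-g) = -pt g := by
  show (((-g.1 : ℤ) : ℝ), ((-g.2 : ℤ) : ℝ)) = _
  simp [pt]

lemma pt_sub (g h : Deck) : pt (g - h) = pt g - pt h := by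
  rw [sub_eq_add_neg, pt_add, pt_neg, sub_eq_add_neg]

lemma pt_zsmul (n : ℤ) (g : Deck) : pt (n • g) = (n : ℝ) • pt g := by
  let f : Deck →+ Plane := ⟨⟨pt, pt_zero⟩, pt_add⟩
  have := map_zsmul f n g
  rw [Int.cast_smul_eq_zsmul]
  exact this

lemma pt_injective : Function.Injective pt := by
  intro g h hgh
  have h1 : (g.1 : ℝ) = h.1 := congrArg Prod.fst hgh
  have h2 : (g.2 : ℝ) = h.2 := congrArg Prod.snd hgh
  exact Prod.ext (by exact_mod_cast h1) (by exact_mod_cast h2)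

lemma mem_range_pt_of_mem_face {T : OneVertexTriangulation} {s : Finset Plane} (hs : s ∈ T.complex.faces) {x : Plane}
    (hx : x ∈ s) : ∃ g, pt g = x := by
  have : x ∈ T.complex.vertices := by
    rw [Geometry.SimplicialComplex.vertices_eq]
    exact mem_biUnion hs hx
  rwa [T.vertices_eq] at this

variable [LinearOrder Deck] [IsOrderedAddMonoid Deck] {ρ : Deck → ℝ → ℝ}

namespace IsAllowedAction

lemma neg_apply (hρ : IsAllowedAction ρ) (g : Deck) (t : ℝ) : ρ (-g) (ρ g t) = t := by
  rw [← hρ.map_add, neg_add_cancel, hρ.map_zero]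

lemma apply_neg (hρ : IsAllowedAction ρ) (g : Deck) (t : ℝ) : ρ g (ρ (-g) t) = t := by
  rw [← hρ.map_add, add_neg_cancel, hρ.map_zero]

/-- A continuous injection of the line is monotone or antitone; an antitone one would reverse the
orbit points of `0 < h`, whose order translation preserves. -/
lemma strictMono (hρ : IsAllowedAction ρ) (g : Deck) : StrictMono (ρ g) := by
  have hinj : Function.Injective (ρ g) := Function.LeftInverse.injective (hρ.neg_apply g)
  refine ((hρ.continuous g).strictMono_of_inj hinj).resolve_right fun hanti => ?_
  obtain ⟨h, hh⟩ := exists_gt (0 : Deck)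
  have h1 := hanti ((hρ.orbit_lt_iff 0 h).2 hh)
  rw [← hρ.map_add, ← hρ.map_add, hρ.orbit_lt_iff] at h1
  exact absurd (lt_of_add_lt_add_left h1) hh.not_gt

lemma orbit_le_iff (hρ : IsAllowedAction ρ) (g h : Deck) : ρ g 0 ≤ ρ h 0 ↔ g ≤ h := by
  rw [← not_lt, hρ.orbit_lt_iff, not_lt]

lemma sub_neg_of_lt (hρ : IsAllowedAction ρ) {p q : Deck} (h : p < q) : ρ (p - q) 0 < 0 := by
  have := (hρ.orbit_lt_iff (p - q) 0).2 (sub_neg.2 h)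
  rwa [hρ.map_zero] at this

end IsAllowedAction

/-- The affine parameter of the point of level `c` on the edge from `p` to `q`, if there is one. -/
noncomputable def edgeParam (ρ : Deck → ℝ → ℝ) (p q : Deck) (c : ℝ) : ℝ :=
  1 - ρ (-q) c / ρ (p - q) 0

/-- The point of level `c` on the line through the edge from `p` to `q`. -/
noncomputable def edgePoint (ρ : Deck → ℝ → ℝ) (p q : Deck) (c : ℝ) : Plane :=
  AffineMap.lineMap (pt p) (pt q) (edgeParam ρ p q c)

namespace IsAllowedAction

lemma edgeParam_strictMono (hρ : IsAllowedAction ρ) {p q : Deck} (h : p < q) :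
    StrictMono (edgeParam ρ p q) := by
  intro c c' hc
  have h1 := hρ.strictMono (-q) hc
  have h2 := hρ.sub_neg_of_lt h
  have := (div_lt_div_right_of_neg h2).2 h1
  unfold edgeParam
  linarith

lemma edgeParam_continuous (hρ : IsAllowedAction ρ) (p q : Deck) :
    Continuous (edgeParam ρ p q) := by
  unfold edgeParam
  have := hρ.continuous (-q)
  fun_prop

lemma edgePoint_continuous (hρ : IsAllowedAction ρ) (p q : Deck) :
    Continuous (edgePoint ρ p q) := by
  have := hρ.edgeParam_continuous p q
  unfold edgePoint
  simp only [AffineMap.lineMap_apply]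
  fun_prop

lemma edgeParam_left (hρ : IsAllowedAction ρ) {p q : Deck} (h : p < q) :
    edgeParam ρ p q (ρ p 0) = 0 := by
  rw [edgeParam, ← hρ.map_add, neg_add_eq_sub, div_self (hρ.sub_neg_of_lt h).ne, sub_self]

lemma edgeParam_right (hρ : IsAllowedAction ρ) (p q : Deck) :
    edgeParam ρ p q (ρ q 0) = 1 := by
  rw [edgeParam, hρ.neg_apply, zero_div, sub_zero]

lemma edgePoint_left (hρ : IsAllowedAction ρ) {p q : Deck} (h : p < q) :
    edgePoint ρ p q (ρ p 0) = pt p := by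
  rw [edgePoint, hρ.edgeParam_left h, AffineMap.lineMap_apply_zero]

lemma edgePoint_right (hρ : IsAllowedAction ρ) (p q : Deck) :
    edgePoint ρ p q (ρ q 0) = pt q := by
  rw [edgePoint, hρ.edgeParam_right, AffineMap.lineMap_apply_one]

/-- Inverts the formula for the defining function on an edge: apply `ρ (-q)` and divide by the
nonzero number `ρ (p - q) 0`. -/
lemma eq_edgeParam_iff (hρ : IsAllowedAction ρ) {p q : Deck} (h : p < q) (u c : ℝ) :
    c = ρ q ((1 - u) * ρ (p - q) 0) ↔ u = edgeParam ρ p q c := by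
  have h2 := (hρ.sub_neg_of_lt h).ne
  constructor
  · rintro rfl
    rw [edgeParam, hρ.neg_apply, mul_div_cancel_right₀ _ h2]
    ring
  · rintro rfl
    rw [edgeParam, sub_sub_cancel, div_mul_cancel₀ _ h2, hρ.apply_neg]

lemma edgeParam_mem_Icc (hρ : IsAllowedAction ρ) {p q : Deck} (h : p < q) {c : ℝ} :
    edgeParam ρ p q c ∈ Icc (0 : ℝ) 1 ↔ c ∈ Icc (ρ p 0) (ρ q 0) := by
  have hm := hρ.edgeParam_strictMono h
  have h0 := hm.le_iff_le (a := ρ p 0) (b := c)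
  have h1 := hm.le_iff_le (a := c) (b := ρ q 0)
  rw [hρ.edgeParam_left h] at h0
  rw [hρ.edgeParam_right] at h1
  rw [mem_Icc, mem_Icc, h0, h1]

lemma mem_skeletonLevel (hρ : IsAllowedAction ρ) (T : OneVertexTriangulation) {c : ℝ} {x : Plane} :
    x ∈ skeletonLevel T ρ c ↔ ∃ p q : Deck, p < q ∧ T.IsEdge p q ∧
      c ∈ Icc (ρ p 0) (ρ q 0) ∧ x = edgePoint ρ p q c := by
  constructor
  · rintro ⟨p, q, hpq, he, u, hu, rfl, hc⟩
    rw [hρ.eq_edgeParam_iff hpq] at hc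
    subst hc
    exact ⟨p, q, hpq, he, (hρ.edgeParam_mem_Icc hpq).1 hu, rfl⟩
  · rintro ⟨p, q, hpq, he, hc, rfl⟩
    exact ⟨p, q, hpq, he, _, (hρ.edgeParam_mem_Icc hpq).2 hc, rfl,
      (hρ.eq_edgeParam_iff hpq _ _).2 rfl⟩

lemma edgePoint_mem_segment (hρ : IsAllowedAction ρ) {p q : Deck} (h : p < q) {c : ℝ}
    (hc : c ∈ Icc (ρ p 0) (ρ q 0)) : edgePoint ρ p q c ∈ segment ℝ (pt p) (pt q) := by
  rw [segment_eq_image_lineMap]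
  exact ⟨_, (hρ.edgeParam_mem_Icc h).2 hc, rfl⟩

lemma edgePoint_eq_left (hρ : IsAllowedAction ρ) {p q : Deck} (h : p < q) {c : ℝ}
    (hc : edgePoint ρ p q c = pt p) : c = ρ p 0 := by
  apply (hρ.edgeParam_strictMono h).injective
  rw [hρ.edgeParam_left h]
  refine AffineMap.lineMap_injective ℝ (pt_injective.ne h.ne) ?_
  rw [AffineMap.lineMap_apply_zero]
  exact hc

lemma edgePoint_eq_right (hρ : IsAllowedAction ρ) {p q : Deck} (h : p < q) {c : ℝ}
    (hc : edgePoint ρ p q c = pt q) : c = ρ q 0 := by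
  apply (hρ.edgeParam_strictMono h).injective
  rw [hρ.edgeParam_right]
  refine AffineMap.lineMap_injective ℝ (pt_injective.ne h.ne) ?_
  rw [AffineMap.lineMap_apply_one]
  exact hc

lemma edgePoint_injective (hρ : IsAllowedAction ρ) {p q : Deck} (h : p < q) :
    Function.Injective (edgePoint ρ p q) :=
  (AffineMap.lineMap_injective ℝ (pt_injective.ne h.ne)).comp
    (hρ.edgeParam_strictMono h).injective

/-- The levels of the 1-skeleton are disjoint. -/
lemma skeletonLevel_unique (hρ : IsAllowedAction ρ) {T : OneVertexTriangulation} {c c' : ℝ}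
    {x : Plane} (h : x ∈ skeletonLevel T ρ c) (h' : x ∈ skeletonLevel T ρ c') : c = c' := by
  rw [hρ.mem_skeletonLevel] at h h'
  obtain ⟨p, q, hpq, ⟨e, he, hes⟩, hc, hx⟩ := h
  obtain ⟨p', q', hpq', ⟨e', he', hes'⟩, hc', hx'⟩ := h'
  -- Two faces meet in the hull of their common vertices: the edges coincide, share just one vertex,
  -- which is then `x`, or are disjoint.
  have hm : x ∈ convexHull ℝ (({pt p, pt q} : Set Plane) ∩ {pt p', pt q'}) := by
    rw [← hes, ← hes']
    refine T.complex.inter_subset_convexHull he he' ⟨?_, ?_⟩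
    · rw [hes, convexHull_pair, hx]
      exact hρ.edgePoint_mem_segment hpq hc
    · rw [hes', convexHull_pair, hx']
      exact hρ.edgePoint_mem_segment hpq' hc'
  have key : ∀ v, (v = p ∨ v = q) → (v = p' ∨ v = q') → x = pt v → c = c' := by
    rintro v h1 h2 hv
    trans ρ v 0
    · rcases h1 with rfl | rfl
      · exact hρ.edgePoint_eq_left hpq (hx.symm.trans hv)
      · exact hρ.edgePoint_eq_right hpq (hx.symm.trans hv)
    · rcases h2 with rfl | rfl
      · exact (hρ.edgePoint_eq_left hpq' (hx'.symm.trans hv)).symm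
      · exact (hρ.edgePoint_eq_right hpq' (hx'.symm.trans hv)).symm
  by_cases hp : p = p' ∨ p = q' <;> by_cases hq : q = p' ∨ q = q'
  · have h1 : p = p' ∧ q = q' := by
      rcases hp with rfl | rfl <;> rcases hq with rfl | rfl
      · exact absurd hpq (lt_irrefl _)
      · exact ⟨rfl, rfl⟩
      · exact absurd hpq hpq'.not_gt
      · exact absurd hpq (lt_irrefl _)
    obtain ⟨rfl, rfl⟩ := h1
    exact hρ.edgePoint_injective hpq (hx.symm.trans hx')
  · refine key p (Or.inl rfl) hp ?_
    have : ({pt p, pt q} : Set Plane) ∩ {pt p', pt q'} ⊆ {pt p} := by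
      rintro y ⟨rfl | rfl, hy⟩
      · rfl
      · exact absurd (hy.imp (fun h => pt_injective h) (fun h => pt_injective h)) hq
    simpa using convexHull_mono this hm
  · refine key q (Or.inr rfl) hq ?_
    have : ({pt p, pt q} : Set Plane) ∩ {pt p', pt q'} ⊆ {pt q} := by
      rintro y ⟨rfl | rfl, hy⟩
      · exact absurd (hy.imp (fun h => pt_injective h) (fun h => pt_injective h)) hp
      · rfl
    simpa using convexHull_mono this hm
  · have : ({pt p, pt q} : Set Plane) ∩ {pt p', pt q'} ⊆ ∅ := by
      rintro y ⟨rfl | rfl, hy⟩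
      · exact absurd (hy.imp (fun h => pt_injective h) (fun h => pt_injective h)) hp
      · exact absurd (hy.imp (fun h => pt_injective h) (fun h => pt_injective h)) hq
    simpa using convexHull_mono this hm

end IsAllowedAction

end Edges

/-! ### Planar geometry of the family of level segments in one triangle. -/

section Sweep

open Set

/-- The data of the levels on the boundary of a triangle with vertices of levels `a < b < d`:
affine parameters `S`, `S'`, `L` of the point of level `c` on the edges `ab`, `bd` and `ad`. -/
structure Sweep (a b d : ℝ) (S S' L : ℝ → ℝ) : Prop where
  lt₁ : a < b
  lt₂ : b < d
  monoS : StrictMono S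
  monoS' : StrictMono S'
  monoL : StrictMono L
  contS : Continuous S
  contS' : Continuous S'
  contL : Continuous L
  Sa : S a = 0
  Sb : S b = 1
  Sb' : S' b = 0
  Sd' : S' d = 1
  La : L a = 0
  Ld : L d = 1

/-- The point with barycentric coordinates `(1 - θ - z, θ, z)` lies on the segment of level `c`. -/
def SweepLevel (b : ℝ) (S S' L : ℝ → ℝ) (c θ z : ℝ) : Prop :=
  ∃ τ ∈ Icc (0 : ℝ) 1, (c ≤ b ∧ θ = τ * S c ∧ z = (1 - τ) * L c) ∨
    (b ≤ c ∧ θ = τ * (1 - S' c) ∧ 1 - θ - z = (1 - τ) * (1 - L c))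

/-- The segment from `(S, 0)` to `(0, L)` moves away from the origin when both ends do, so on a line
of constant first coordinate the outer segment is met strictly higher. -/
lemma segment_sweep_le {S L S' L' τ τ' : ℝ} (hτ : τ ∈ Icc (0 : ℝ) 1) (hτ' : τ' ∈ Icc (0 : ℝ) 1)
    (hS' : 0 ≤ S') (hL' : 0 ≤ L') (hS : S' < S) (hL : L' < L) (hθ : τ * S = τ' * S')
    (hz : (1 - τ) * L ≤ (1 - τ') * L') : False := by
  obtain ⟨h0, h1⟩ := hτ
  obtain ⟨h0', h1'⟩ := hτ'
  have hle : τ ≤ τ' := by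
    by_contra! h
    nlinarith [mul_nonneg h0' (sub_nonneg.2 hS.le), mul_pos (sub_pos.2 h) (hS'.trans_lt hS)]
  have h2 : τ' = 1 := by
    by_contra h
    have : τ' < 1 := lt_of_le_of_ne h1' h
    nlinarith [mul_pos (sub_pos.2 this) (sub_pos.2 hL), mul_nonneg (sub_nonneg.2 hle)
      (hL'.trans hL.le)]
  subst h2
  have h3 : τ = 1 := by
    by_contra h
    have : τ < 1 := lt_of_le_of_ne h1 h
    nlinarith [mul_pos (sub_pos.2 this) (hL'.trans_lt hL)]
  subst h3
  linarith

lemma exists_segment_sweep {a b θ z l : ℝ} {S L : ℝ → ℝ} (hab : a ≤ b) (hS : StrictMonoOn S (Icc a b))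
    (cS : ContinuousOn S (Icc a b)) (cL : ContinuousOn L (Icc a b))
    (Sa : S a = 0) (Sb : S b = 1) (La : L a = 0) (Lb : L b = l) (hθ : 0 ≤ θ) (hz : 0 ≤ z)
    (hθ1 : θ ≤ 1) (h : z ≤ (1 - θ) * l) :
    ∃ c ∈ Icc a b, ∃ τ ∈ Icc (0 : ℝ) 1, θ = τ * S c ∧ z = (1 - τ) * L c := by
  rcases hθ.eq_or_lt with rfl | hθ0
  · obtain ⟨c, hc, hcz⟩ := intermediate_value_Icc hab cL (by
      rw [La, Lb]; exact ⟨hz, by simpa using h⟩ : z ∈ Icc (L a) (L b))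
    exact ⟨c, hc, 0, by simp, by simp, by simp [hcz]⟩
  · obtain ⟨c₀, hc₀, hcθ⟩ := intermediate_value_Icc hab cS (by
      rw [Sa, Sb]; exact ⟨hθ, hθ1⟩ : θ ∈ Icc (S a) (S b))
    have hsub : Icc c₀ b ⊆ Icc a b := Icc_subset_Icc_left hc₀.1
    -- The function vanishes exactly when `(θ, z)` satisfies the cleared equation of the line
    -- through `(S c, 0)` and `(0, L c)`. It equals `-z * θ` at `c₀` and `(1 - θ) * l - z` at `b`.
    obtain ⟨c, hc, hK⟩ := intermediate_value_Icc (f := fun c => S c * L c - θ * L c - z * S c)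
      hc₀.2 (((cS.mul cL).sub (continuousOn_const.mul cL)).sub (continuousOn_const.mul cS) |>.mono
        hsub) (by
        simp only [Sb, Lb, hcθ]
        constructor <;> nlinarith : (0 : ℝ) ∈ Icc _ _)
    simp only at hK
    have hSc : θ ≤ S c := by
      rw [← hcθ]
      exact hS.monotoneOn hc₀ (hsub hc) hc.1
    have hSpos : 0 < S c := hθ0.trans_le hSc
    refine ⟨c, hsub hc, θ / S c, ⟨by positivity, (div_le_one hSpos).2 hSc⟩, ?_, ?_⟩
    · field_simp
    · field_simp
      linarith

namespace Sweep

variable {a b d : ℝ} {S S' L : ℝ → ℝ}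

/-- Level segments do not cross. Below `b` they sweep away from the lowest vertex and above `b`
towards the highest one; the upper case is the lower one reflected, with `1 - θ - z` in place of
`z`. -/
lemma le_of_le (h : Sweep a b d S S' L) {c c' θ z z' : ℝ} (hc : c ∈ Icc a d) (hc' : c' ∈ Icc a d)
    (hl : SweepLevel b S S' L c θ z) (hl' : SweepLevel b S S' L c' θ z') (hz : z ≤ z') :
    c ≤ c' := by
  by_contra! hlt
  have hS := h.monoS hlt
  have hS' := h.monoS' hlt
  have hL := h.monoL hlt
  have hLa := h.monoL.monotone hc'.1
  have hLd := h.monoL.monotone hc.2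
  have hSa := h.monoS.monotone hc'.1
  have hSd' := h.monoS'.monotone hc.2
  rw [h.La] at hLa
  rw [h.Ld] at hLd
  rw [h.Sa] at hSa
  rw [h.Sd'] at hSd'
  obtain ⟨τ, hτ, ⟨hcb, rfl, rfl⟩ | ⟨hcb, rfl, h1⟩⟩ := hl <;>
    obtain ⟨τ', hτ', ⟨hcb', h2, rfl⟩ | ⟨hcb', h2, h3⟩⟩ := hl'
  · exact segment_sweep_le hτ hτ' hSa hLa hS hL h2 hz
  · linarith
  -- Levels on opposite sides of `b`: a violation forces `θ = 1`, the middle vertex, and then both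
  -- levels equal `b`.
  · have e1 := h.monoL.monotone hcb
    have e2 := h.monoL.monotone hcb'
    have e3 := h.monoS.monotone hcb'
    have e4 := h.monoS'.monotone hcb
    rw [h.Sb] at e3
    rw [h.Sb'] at e4
    have hLlt : 0 < L c - L c' := by linarith
    obtain ⟨t0, t1⟩ := hτ
    obtain ⟨t0', t1'⟩ := hτ'
    have f1 : τ' * S c' ≤ τ' := by nlinarith
    have f2 : τ * (1 - S' c) ≤ τ := by nlinarith
    have f3 : (1 - τ') * L c' ≤ (1 - τ * (1 - S' c)) * L c' :=
      mul_le_mul_of_nonneg_right (by linarith) hLa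
    have f4 : (1 - τ) * (1 - L c) ≤ (1 - τ * (1 - S' c)) * (1 - L c) :=
      mul_le_mul_of_nonneg_right (by linarith) (by linarith)
    have f5 : (1 - τ * (1 - S' c)) * (L c - L c') ≤ 0 := by nlinarith
    have f6 : 1 - τ * (1 - S' c) = 0 := by
      by_contra hne
      have : 0 < 1 - τ * (1 - S' c) := lt_of_le_of_ne (by linarith) (Ne.symm hne)
      nlinarith [mul_pos this hLlt]
    have f7 : S c' = 1 := by nlinarith
    have f8 : S' c = 0 := by nlinarith
    have g1 : c' = b := h.monoS.injective (f7.trans h.Sb.symm)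
    have g2 : c = b := h.monoS'.injective (f8.trans h.Sb'.symm)
    linarith
  · refine segment_sweep_le hτ' hτ (by linarith) (by linarith) (by linarith : 1 - S' c < 1 - S' c')
      (by linarith : 1 - L c < 1 - L c') h2.symm (by linarith)

/-- A level segment is transversal to the lines of constant `θ`, except at the lowest and highest
levels, where it is a single point. At level `b` the two descriptions agree because `S b = 1` and
`S' b = 0`. -/
lemma eq_of_level (h : Sweep a b d S S' L) {c θ z z' : ℝ} (hc : c ∈ Icc a d)
    (hl : SweepLevel b S S' L c θ z) (hl' : SweepLevel b S S' L c θ z') : z = z' := by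
  have hLa := h.monoL.monotone hc.1
  have hLd := h.monoL.monotone hc.2
  rw [h.La] at hLa
  rw [h.Ld] at hLd
  have low : ∀ {τ τ' : ℝ}, τ * S c = τ' * S c → (1 - τ) * L c = (1 - τ') * L c := by
    intro τ τ' he
    by_cases hS : S c = 0
    · rw [h.monoS.injective (hS.trans h.Sa.symm), h.La]
      simp
    · rw [mul_right_cancel₀ hS he]
  have upp : ∀ {τ τ' : ℝ}, τ * (1 - S' c) = τ' * (1 - S' c) →
      (1 - τ) * (1 - L c) = (1 - τ') * (1 - L c) := by
    intro τ τ' he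
    by_cases hS : 1 - S' c = 0
    · rw [h.monoS'.injective ((show S' c = 1 by linarith).trans h.Sd'.symm), h.Ld]
      simp
    · rw [mul_right_cancel₀ hS he]
  obtain ⟨τ, hτ, ⟨hcb, h1, h2⟩ | ⟨hcb, h1, h2⟩⟩ := hl <;>
    obtain ⟨τ', hτ', ⟨hcb', h3, h4⟩ | ⟨hcb', h3, h4⟩⟩ := hl'
  · rw [h2, h4, low (h1.symm.trans h3)]
  · obtain rfl := le_antisymm hcb hcb'
    simp only [h.Sb, h.Sb', mul_one, sub_zero] at *
    subst h1 h3
    linarith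
  · obtain rfl := le_antisymm hcb hcb'
    simp only [h.Sb, h.Sb', mul_one, sub_zero] at *
    subst h1 h3
    linarith
  · have := upp (h1.symm.trans h3)
    linarith

lemma exists_level (h : Sweep a b d S S' L) {θ z : ℝ} (hθ : 0 ≤ θ) (hz : 0 ≤ z) (hθz : θ + z ≤ 1) :
    ∃ c ∈ Icc a d, SweepLevel b S S' L c θ z := by
  rcases le_total z ((1 - θ) * L b) with hle | hle
  · obtain ⟨c, hc, τ, hτ, h1, h2⟩ := exists_segment_sweep h.lt₁.le (h.monoS.strictMonoOn _)
      h.contS.continuousOn h.contL.continuousOn h.Sa h.Sb h.La rfl hθ hz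
      (by linarith) hle
    exact ⟨c, ⟨hc.1, hc.2.trans h.lt₂.le⟩, τ, hτ, Or.inl ⟨hc.2, h1, h2⟩⟩
  -- Above the segment of level `b`, reversing levels and exchanging the lowest and highest vertices
  -- reduces to the lower half.
  · obtain ⟨c, hc, τ, hτ, h1, h2⟩ := exists_segment_sweep (a := -d) (b := -b)
      (S := fun c => 1 - S' (-c)) (L := fun c => 1 - L (-c)) (θ := θ) (z := 1 - θ - z)
      (neg_le_neg h.lt₂.le)
      (fun x _ y _ hxy => sub_lt_sub_left (h.monoS' (neg_lt_neg hxy)) 1)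
      (continuous_const.sub (h.contS'.comp continuous_neg)).continuousOn
      (continuous_const.sub (h.contL.comp continuous_neg)).continuousOn
      (by simp [h.Sd']) (by simp [h.Sb']) (by simp [h.Ld]) rfl hθ (by linarith) (by linarith)
      (by simp only [neg_neg]; nlinarith)
    exact ⟨-c, ⟨by linarith [hc.2, h.lt₁], by linarith [hc.1]⟩, τ, hτ,
      Or.inr ⟨by linarith [hc.2], h1, h2⟩⟩

/-- A level segment meets the boundary of the triangle only in its endpoints. This allows levels in
neighbouring triangles to be compared on their common face. -/
lemma boundary (h : Sweep a b d S S' L) {c θ z : ℝ} (hc : c ∈ Icc a d)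
    (hl : SweepLevel b S S' L c θ z) (hb : θ = 0 ∨ z = 0 ∨ θ + z = 1) :
    (θ = 0 ∧ z = L c) ∨ (c ≤ b ∧ θ = S c ∧ z = 0) ∨ (b ≤ c ∧ θ = 1 - S' c ∧ z = S' c) := by
  have hLa := h.monoL.monotone hc.1
  have hLd := h.monoL.monotone hc.2
  have hSa := h.monoS.monotone hc.1
  have hSd' := h.monoS'.monotone hc.2
  have hLb0 := h.monoL h.lt₁
  have hLb1 := h.monoL h.lt₂
  rw [h.La] at hLa hLb0
  rw [h.Ld] at hLd hLb1
  rw [h.Sa] at hSa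
  rw [h.Sd'] at hSd'
  have hLS : L c = 0 → S c = 0 := fun e => by
    rw [h.monoL.injective (e.trans h.La.symm), h.Sa]
  have hSL : S c = 0 → L c = 0 := fun e => by
    rw [h.monoS.injective (e.trans h.Sa.symm), h.La]
  have hLS' : L c = 1 → S' c = 1 := fun e => by
    rw [h.monoL.injective (e.trans h.Ld.symm), h.Sd']
  have hSL' : S' c = 1 → L c = 1 := fun e => by
    rw [h.monoS'.injective (e.trans h.Sd'.symm), h.Ld]
  obtain ⟨τ, ⟨t0, t1⟩, ⟨hcb, rfl, rfl⟩ | ⟨hcb, rfl, h2⟩⟩ := hl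
  · have e1 := h.monoL.monotone hcb
    have e2 := h.monoS.monotone hcb
    rw [h.Sb] at e2
    rcases hb with hb | hb | hb
    · left
      rcases mul_eq_zero.1 hb with rfl | hb
      · simp
      · simp [hb, hSL hb]
    · rcases mul_eq_zero.1 hb with hb | hb
      · right; left
        have : τ = 1 := by linarith
        subst this
        simp [hcb]
      · left
        simp [hb, hLS hb]
    · right; left
      have : τ = 1 := by
        by_contra hne
        have : τ < 1 := lt_of_le_of_ne t1 hne
        nlinarith
      subst this
      simp [hcb]
  · have e1 := h.monoL.monotone hcb
    have e2 := h.monoS'.monotone hcb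
    rw [h.Sb'] at e2
    have hz : z = 1 - τ * (1 - S' c) - (1 - τ) * (1 - L c) := by linarith
    subst hz
    rcases hb with hb | hb | hb
    · left
      rcases mul_eq_zero.1 hb with rfl | hb
      · simp
      · have h1 : S' c = 1 := by linarith
        simp [h1, hSL' h1]
    · right; right
      have : τ = 1 := by
        by_contra hne
        have : τ < 1 := lt_of_le_of_ne t1 hne
        nlinarith [mul_pos (sub_pos.2 this) (hLb0.trans_le e1), mul_nonneg t0 e2]
      subst this
      refine ⟨hcb, by ring, by ring⟩
    · have h3 : (1 - τ) * (1 - L c) = 0 := by linarith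
      rcases mul_eq_zero.1 h3 with h3 | h3
      · right; right
        have : τ = 1 := by linarith
        subst this
        refine ⟨hcb, by ring, by ring⟩
      · left
        have h4 : L c = 1 := by linarith
        simp [h4, hLS' h4]

end Sweep

end Sweep

/-! ### The defining function on a single triangle, and its uniqueness across triangles. -/

section Triangles

open Set

variable [LinearOrder Deck] [IsOrderedAddMonoid Deck] {ρ : Deck → ℝ → ℝ}
  {T : OneVertexTriangulation}

/-- `t` is a triangle of the triangulation with vertices `p < q < r`. -/
structure IsOrderedTriangle (T : OneVertexTriangulation) (p q r : Deck) (t : Finset Plane) :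
    Prop where
  lt₁ : p < q
  lt₂ : q < r
  mem : t ∈ T.complex.faces
  coe_eq : (t : Set Plane) = {pt p, pt q, pt r}

lemma OneVertexTriangulation.IsTriangle.exists_isOrderedTriangle {t : Finset Plane}
    (ht : T.IsTriangle t) : ∃ p q r, IsOrderedTriangle T p q r t := by
  classical
  obtain ⟨hf, hcard⟩ := ht
  obtain ⟨x, y, z, hxy, hxz, hyz, rfl⟩ := Finset.card_eq_three.1 hcard
  obtain ⟨a, rfl⟩ := mem_range_pt_of_mem_face hf (x := x) (by simp)
  obtain ⟨b, rfl⟩ := mem_range_pt_of_mem_face hf (x := y) (by simp)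
  obtain ⟨c, rfl⟩ := mem_range_pt_of_mem_face hf (x := z) (by simp)
  have hab : a ≠ b := fun h => hxy (by rw [h])
  have hac : a ≠ c := fun h => hxz (by rw [h])
  have hbc : b ≠ c := fun h => hyz (by rw [h])
  rcases lt_or_gt_of_ne hab with h1 | h1 <;> rcases lt_or_gt_of_ne hac with h2 | h2 <;>
    rcases lt_or_gt_of_ne hbc with h3 | h3
  · exact ⟨a, b, c, h1, h3, hf, by simp⟩
  · exact ⟨a, c, b, h2, h3, hf, by ext; simp; tauto⟩
  · exact absurd (h1.trans h3) h2.not_gt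
  · exact ⟨c, a, b, h2, h1, hf, by ext; simp; tauto⟩
  · exact ⟨b, a, c, h1, h2, hf, by ext; simp; tauto⟩
  · exact absurd (h2.trans h3) h1.not_gt
  · exact ⟨b, c, a, h3, h2, hf, by ext; simp; tauto⟩
  · exact ⟨c, b, a, h3, h1, hf, by ext; simp; tauto⟩

namespace IsOrderedTriangle

variable {p q r : Deck} {t : Finset Plane}

lemma eq_image [DecidableEq Plane] (h : IsOrderedTriangle T p q r t) :
    t = {pt p, pt q, pt r} := by
  rw [← Finset.coe_inj, h.coe_eq]
  simp

lemma isTriangle (h : IsOrderedTriangle T p q r t) : T.IsTriangle t := by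
  classical
  refine ⟨h.mem, ?_⟩
  rw [h.eq_image, Finset.card_eq_three]
  exact ⟨_, _, _, pt_injective.ne h.lt₁.ne, pt_injective.ne (h.lt₁.trans h.lt₂).ne,
    pt_injective.ne h.lt₂.ne, rfl⟩

lemma isEdge (h : IsOrderedTriangle T p q r t) {v w : Deck} (hv : v = p ∨ v = q ∨ v = r)
    (hw : w = p ∨ w = q ∨ w = r) : T.IsEdge v w := by
  classical
  refine ⟨{pt v, pt w}, T.complex.down_closed h.mem ?_ (by simp), by simp⟩
  rw [h.eq_image]
  rcases hv with rfl | rfl | rfl <;> rcases hw with rfl | rfl | rfl <;> intro x <;> simp <;> tauto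

lemma linearIndependent (h : IsOrderedTriangle T p q r t) {α β : ℝ}
    (he : α • (pt q - pt p) + β • (pt r - pt p) = 0) : α = 0 ∧ β = 0 := by
  have hind := T.complex.indep h.mem
  have hmem : ∀ i, ![pt p, pt q, pt r] i ∈ t := by
    intro i
    have : ![pt p, pt q, pt r] i ∈ (t : Set Plane) := by
      rw [h.coe_eq]
      fin_cases i <;> simp
    exact this
  let f : Fin 3 ↪ t := ⟨fun i => ⟨![pt p, pt q, pt r] i, hmem i⟩, by
    have h1 := pt_injective.ne h.lt₁.ne
    have h2 := pt_injective.ne h.lt₂.ne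
    have h3 := pt_injective.ne (h.lt₁.trans h.lt₂).ne
    intro i j hij
    have hij' := congrArg Subtype.val hij
    fin_cases i <;> fin_cases j <;> simp_all⟩
  have h2 : AffineIndependent ℝ ![pt p, pt q, pt r] := hind.comp_embedding f
  rw [affineIndependent_iff] at h2
  have h3 := h2 Finset.univ ![-(α + β), α, β] (by simp [Fin.sum_univ_three]) (by
    simp only [Fin.sum_univ_three, Matrix.cons_val]
    rw [← he]
    module)
  exact ⟨by simpa using h3 1, by simpa using h3 2⟩

/-- Affine coordinates on the plane adapted to a triangle. -/
def toPlane (p q r : Deck) (θ z : ℝ) : Plane := pt p + θ • (pt q - pt p) + z • (pt r - pt p)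

lemma toPlane_inj (h : IsOrderedTriangle T p q r t) {θ z θ' z' : ℝ}
    (he : toPlane p q r θ z = toPlane p q r θ' z') : θ = θ' ∧ z = z' := by
  have := h.linearIndependent (α := θ - θ') (β := z - z') (by
    rw [← sub_eq_zero] at he
    rw [← he, toPlane, toPlane]
    module)
  exact ⟨by linarith, by linarith⟩

lemma mem_convexHull (h : IsOrderedTriangle T p q r t) {x : Plane} :
    x ∈ convexHull ℝ (t : Set Plane) ↔
      ∃ θ z : ℝ, 0 ≤ θ ∧ 0 ≤ z ∧ θ + z ≤ 1 ∧ x = toPlane p q r θ z := by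
  rw [h.coe_eq, convexHull_insert (by simp), convexHull_pair]
  simp only [mem_convexJoin, mem_singleton_iff, exists_eq_left, segment_eq_image_lineMap]
  constructor
  · rintro ⟨_, ⟨u, hu, rfl⟩, v, hv, rfl⟩
    refine ⟨v * (1 - u), v * u, mul_nonneg hv.1 (by linarith [hu.2]), mul_nonneg hv.1 hu.1,
      by nlinarith [hv.2], ?_⟩
    simp only [AffineMap.lineMap_apply, toPlane, vsub_eq_sub, vadd_eq_add]
    module
  · rintro ⟨θ, z, hθ, hz, hs, rfl⟩
    rcases (add_nonneg hθ hz).eq_or_lt with h0 | h0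
    · refine ⟨pt q, ⟨0, by simp, by simp⟩, 0, by simp, ?_⟩
      have : θ = 0 := by linarith
      have : z = 0 := by linarith
      subst θ z
      simp [toPlane]
    · refine ⟨_, ⟨z / (θ + z), ⟨by positivity, (div_le_one h0).2 (by linarith)⟩, rfl⟩, θ + z,
        ⟨h0.le, hs⟩, ?_⟩
      have e1 : (θ + z) * (z / (θ + z)) = z := mul_div_cancel₀ _ h0.ne'
      simp only [AffineMap.lineMap_apply, toPlane, vsub_eq_sub, vadd_eq_add]
      have : θ • (pt q - pt p) + z • (pt r - pt p) = (θ + z) • (pt q - pt p) +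
          ((θ + z) * (z / (θ + z))) • (pt r - pt q) := by
        rw [e1]
        module
      rw [add_assoc, this]
      module

/-- The point of level `c` on the path from `p` to `r` through `q`. -/
noncomputable def midPoint (ρ : Deck → ℝ → ℝ) (p q r : Deck) (c : ℝ) : Plane :=
  open Classical in if c ≤ ρ q 0 then edgePoint ρ p q c else edgePoint ρ q r c

lemma midPoint_of_le {c : ℝ} (hc : c ≤ ρ q 0) : midPoint ρ p q r c = edgePoint ρ p q c :=
  if_pos hc

lemma midPoint_of_ge (hρ : IsAllowedAction ρ) (h : IsOrderedTriangle T p q r t) {c : ℝ}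
    (hc : ρ q 0 ≤ c) : midPoint ρ p q r c = edgePoint ρ q r c := by
  rcases hc.eq_or_lt with rfl | hc
  · rw [midPoint_of_le le_rfl, hρ.edgePoint_right, hρ.edgePoint_left h.lt₂]
  · exact if_neg hc.not_ge

lemma midPoint_continuous (hρ : IsAllowedAction ρ) (h : IsOrderedTriangle T p q r t) :
    Continuous (midPoint ρ p q r) := by
  classical
  refine Continuous.congr (Continuous.if_le (hρ.edgePoint_continuous p q)
    (hρ.edgePoint_continuous q r) continuous_id (continuous_const (y := ρ q 0)) ?_) ?_
  · rintro _ rfl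
    rw [hρ.edgePoint_right, hρ.edgePoint_left h.lt₂]
  · intro c
    simp only [midPoint, id]

lemma sweep (hρ : IsAllowedAction ρ) (h : IsOrderedTriangle T p q r t) :
    Sweep (ρ p 0) (ρ q 0) (ρ r 0) (edgeParam ρ p q) (edgeParam ρ q r) (edgeParam ρ p r) where
  lt₁ := (hρ.orbit_lt_iff _ _).2 h.lt₁
  lt₂ := (hρ.orbit_lt_iff _ _).2 h.lt₂
  monoS := hρ.edgeParam_strictMono h.lt₁
  monoS' := hρ.edgeParam_strictMono h.lt₂
  monoL := hρ.edgeParam_strictMono (h.lt₁.trans h.lt₂)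
  contS := hρ.edgeParam_continuous _ _
  contS' := hρ.edgeParam_continuous _ _
  contL := hρ.edgeParam_continuous _ _
  Sa := hρ.edgeParam_left h.lt₁
  Sb := hρ.edgeParam_right _ _
  Sb' := hρ.edgeParam_left h.lt₂
  Sd' := hρ.edgeParam_right _ _
  La := hρ.edgeParam_left (h.lt₁.trans h.lt₂)
  Ld := hρ.edgeParam_right _ _

lemma edgePoint_eq_toPlane_long (ρ : Deck → ℝ → ℝ) (p q r : Deck) (c : ℝ) :
    edgePoint ρ p r c = toPlane p q r 0 (edgeParam ρ p r c) := by
  simp only [edgePoint, AffineMap.lineMap_apply, toPlane, vsub_eq_sub, vadd_eq_add]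
  module

lemma edgePoint_eq_toPlane_low (ρ : Deck → ℝ → ℝ) (p q r : Deck) (c : ℝ) :
    edgePoint ρ p q c = toPlane p q r (edgeParam ρ p q c) 0 := by
  simp only [edgePoint, AffineMap.lineMap_apply, toPlane, vsub_eq_sub, vadd_eq_add]
  module

lemma edgePoint_eq_toPlane_high (ρ : Deck → ℝ → ℝ) (p q r : Deck) (c : ℝ) :
    edgePoint ρ q r c = toPlane p q r (1 - edgeParam ρ q r c) (edgeParam ρ q r c) := by
  simp only [edgePoint, AffineMap.lineMap_apply, toPlane, vsub_eq_sub, vadd_eq_add]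
  module

/-- An edge meets the triangle in the hull of common vertices, so it is an edge of the triangle or
contributes at most a vertex. -/
lemma skeletonLevel_inter_cases (hρ : IsAllowedAction ρ) (h : IsOrderedTriangle T p q r t) {c : ℝ}
    {x : Plane} (hx : x ∈ skeletonLevel T ρ c ∩ convexHull ℝ (t : Set Plane)) :
    (∃ v, (v = p ∨ v = q ∨ v = r) ∧ c = ρ v 0 ∧ x = pt v) ∨
      ∃ v w, (v = p ∨ v = q ∨ v = r) ∧ (w = p ∨ w = q ∨ w = r) ∧ v < w ∧
        c ∈ Icc (ρ v 0) (ρ w 0) ∧ x = edgePoint ρ v w c := by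
  obtain ⟨hx, hxt⟩ := hx
  rw [hρ.mem_skeletonLevel] at hx
  obtain ⟨v, w, hvw, ⟨e, he, hes⟩, hc, hxe⟩ := hx
  have hm : x ∈ convexHull ℝ (({pt v, pt w} : Set Plane) ∩ {pt p, pt q, pt r}) := by
    rw [← hes, ← h.coe_eq]
    refine T.complex.inter_subset_convexHull he h.mem ⟨?_, hxt⟩
    rw [hes, convexHull_pair, hxe]
    exact hρ.edgePoint_mem_segment hvw hc
  have hinj : ∀ {u : Deck}, pt u ∈ ({pt p, pt q, pt r} : Set Plane) → u = p ∨ u = q ∨ u = r :=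
    fun hy => hy.imp (fun h => pt_injective h)
      (fun h => h.imp (fun h => pt_injective h) (fun h => pt_injective h))
  by_cases hv : v = p ∨ v = q ∨ v = r <;> by_cases hw : w = p ∨ w = q ∨ w = r
  · exact Or.inr ⟨v, w, hv, hw, hvw, hc, hxe⟩
  · have : ({pt v, pt w} : Set Plane) ∩ {pt p, pt q, pt r} ⊆ {pt v} := by
      rintro y ⟨rfl | rfl, hy⟩
      · rfl
      · exact absurd (hinj hy) hw
    have hxv : x = pt v := by simpa using convexHull_mono this hm
    exact Or.inl ⟨v, hv, hρ.edgePoint_eq_left hvw (hxe.symm.trans hxv), hxv⟩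
  · have : ({pt v, pt w} : Set Plane) ∩ {pt p, pt q, pt r} ⊆ {pt w} := by
      rintro y ⟨rfl | rfl, hy⟩
      · exact absurd (hinj hy) hv
      · rfl
    have hxv : x = pt w := by simpa using convexHull_mono this hm
    exact Or.inl ⟨w, hw, hρ.edgePoint_eq_right hvw (hxe.symm.trans hxv), hxv⟩
  · have : ({pt v, pt w} : Set Plane) ∩ {pt p, pt q, pt r} ⊆ ∅ := by
      rintro y ⟨rfl | rfl, hy⟩
      · exact absurd (hinj hy) hv
      · exact absurd (hinj hy) hw
    simpa using convexHull_mono this hm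

lemma level_mem_Icc (hρ : IsAllowedAction ρ) (h : IsOrderedTriangle T p q r t)
    {c : ℝ} (hc : (skeletonLevel T ρ c ∩ convexHull ℝ (t : Set Plane)).Nonempty) :
    c ∈ Icc (ρ p 0) (ρ r 0) := by
  obtain ⟨x, hx⟩ := hc
  have hb : ∀ v, (v = p ∨ v = q ∨ v = r) → ρ p 0 ≤ ρ v 0 ∧ ρ v 0 ≤ ρ r 0 := by
    rintro v (rfl | rfl | rfl) <;> simp only [hρ.orbit_le_iff, le_refl, true_and, and_true]
    · exact (h.lt₁.trans h.lt₂).le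
    · exact ⟨h.lt₁.le, h.lt₂.le⟩
    · exact (h.lt₁.trans h.lt₂).le
  rcases h.skeletonLevel_inter_cases hρ hx with ⟨v, hv, rfl, -⟩ | ⟨v, w, hv, hw, -, hc, -⟩
  · exact hb v hv
  · exact ⟨(hb v hv).1.trans hc.1, hc.2.trans (hb w hw).2⟩

/-- The boundary consists of two paths from `p` to `r`, the long edge and the path through `q`. The
level increases strictly along each and so is met once on each; the hull is therefore a segment,
possibly degenerate. -/
lemma skeletonLevel_inter (hρ : IsAllowedAction ρ) (h : IsOrderedTriangle T p q r t) {c : ℝ}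
    (hc : c ∈ Icc (ρ p 0) (ρ r 0)) :
    skeletonLevel T ρ c ∩ convexHull ℝ (t : Set Plane) =
      {edgePoint ρ p r c, midPoint ρ p q r c} := by
  have hpq := (hρ.orbit_lt_iff _ _).2 h.lt₁
  have hqr := (hρ.orbit_lt_iff _ _).2 h.lt₂
  apply Subset.antisymm
  · intro x hx
    rcases h.skeletonLevel_inter_cases hρ hx with ⟨v, hv, rfl, rfl⟩ | ⟨v, w, hv, hw, hvw, hcv, rfl⟩
    · rcases hv with rfl | rfl | rfl
      · left
        rw [hρ.edgePoint_left (h.lt₁.trans h.lt₂)]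
      · right
        rw [midPoint_of_le le_rfl, hρ.edgePoint_right]
        rfl
      · left
        rw [hρ.edgePoint_right]
    · rcases hv with rfl | rfl | rfl <;> rcases hw with rfl | rfl | rfl
      · exact absurd hvw (lt_irrefl _)
      · right
        rw [midPoint_of_le hcv.2]
        rfl
      · exact Or.inl rfl
      · exact absurd hvw h.lt₁.not_gt
      · exact absurd hvw (lt_irrefl _)
      · right
        rw [h.midPoint_of_ge hρ hcv.1]
        rfl
      · exact absurd hvw (h.lt₁.trans h.lt₂).not_gt
      · exact absurd hvw h.lt₂.not_gt
      · exact absurd hvw (lt_irrefl _)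
  · have key : ∀ v w, (v = p ∨ v = q ∨ v = r) → (w = p ∨ w = q ∨ w = r) → v < w →
        c ∈ Icc (ρ v 0) (ρ w 0) →
        edgePoint ρ v w c ∈ skeletonLevel T ρ c ∩ convexHull ℝ (t : Set Plane) := by
      intro v w hv hw hvw hc
      refine ⟨(hρ.mem_skeletonLevel T).2 ⟨v, w, hvw, h.isEdge hv hw, hc, rfl⟩, ?_⟩
      have hsub : ({pt v, pt w} : Set Plane) ⊆ t := by
        rw [h.coe_eq]
        rintro x (rfl | rfl)
        · rcases hv with rfl | rfl | rfl <;> simp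
        · rcases hw with rfl | rfl | rfl <;> simp
      have := hρ.edgePoint_mem_segment hvw hc
      rw [← convexHull_pair] at this
      exact convexHull_mono hsub this
    rintro x (rfl | rfl)
    · exact key p r (by simp) (by simp) (h.lt₁.trans h.lt₂) hc
    · rcases le_total c (ρ q 0) with hcq | hcq
      · rw [midPoint_of_le hcq]
        exact key p q (by simp) (by simp) h.lt₁ ⟨hc.1, hcq⟩
      · rw [h.midPoint_of_ge hρ hcq]
        exact key q r (by simp) (by simp) h.lt₂ ⟨hcq, hc.2⟩

lemma lineMap_eq_toPlane (hρ : IsAllowedAction ρ) (h : IsOrderedTriangle T p q r t) {c τ : ℝ} :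
    (c ≤ ρ q 0 → AffineMap.lineMap (edgePoint ρ p r c) (midPoint ρ p q r c) τ =
      toPlane p q r (τ * edgeParam ρ p q c) ((1 - τ) * edgeParam ρ p r c)) ∧
    (ρ q 0 ≤ c → AffineMap.lineMap (edgePoint ρ p r c) (midPoint ρ p q r c) τ =
      toPlane p q r (τ * (1 - edgeParam ρ q r c))
        (1 - τ * (1 - edgeParam ρ q r c) - (1 - τ) * (1 - edgeParam ρ p r c))) := by
  constructor <;> intro hc
  · rw [midPoint_of_le hc, edgePoint_eq_toPlane_long ρ p q r, edgePoint_eq_toPlane_low ρ p q r]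
    simp only [AffineMap.lineMap_apply, toPlane, vsub_eq_sub, vadd_eq_add]
    module
  · rw [h.midPoint_of_ge hρ hc, edgePoint_eq_toPlane_long ρ p q r,
      edgePoint_eq_toPlane_high ρ p q r]
    simp only [AffineMap.lineMap_apply, toPlane, vsub_eq_sub, vadd_eq_add]
    module

lemma mem_level_iff_exists_lineMap (hρ : IsAllowedAction ρ) (h : IsOrderedTriangle T p q r t)
    {c : ℝ} (hc : c ∈ Icc (ρ p 0) (ρ r 0)) {x : Plane} :
    x ∈ convexHull ℝ (skeletonLevel T ρ c ∩ convexHull ℝ (t : Set Plane)) ↔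
      ∃ τ ∈ Icc (0 : ℝ) 1,
        x = AffineMap.lineMap (edgePoint ρ p r c) (midPoint ρ p q r c) τ := by
  rw [h.skeletonLevel_inter hρ hc, convexHull_pair, segment_eq_image_lineMap]
  simp only [mem_image, eq_comm]

lemma mem_level_iff (hρ : IsAllowedAction ρ) (h : IsOrderedTriangle T p q r t) {c : ℝ}
    (hc : c ∈ Icc (ρ p 0) (ρ r 0)) {x : Plane} :
    x ∈ convexHull ℝ (skeletonLevel T ρ c ∩ convexHull ℝ (t : Set Plane)) ↔
      ∃ θ z, x = toPlane p q r θ z ∧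
        SweepLevel (ρ q 0) (edgeParam ρ p q) (edgeParam ρ q r) (edgeParam ρ p r) c θ z := by
  rw [h.mem_level_iff_exists_lineMap hρ hc]
  constructor
  · rintro ⟨τ, hτ, rfl⟩
    rcases le_total c (ρ q 0) with hcq | hcq
    · exact ⟨_, _, (h.lineMap_eq_toPlane hρ).1 hcq, τ, hτ, Or.inl ⟨hcq, rfl, rfl⟩⟩
    · exact ⟨_, _, (h.lineMap_eq_toPlane hρ).2 hcq, τ, hτ, Or.inr ⟨hcq, rfl, by ring⟩⟩
  · rintro ⟨θ, z, rfl, τ, hτ, ⟨hcq, rfl, rfl⟩ | ⟨hcq, rfl, hz⟩⟩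
    · exact ⟨τ, hτ, ((h.lineMap_eq_toPlane hρ).1 hcq).symm⟩
    · refine ⟨τ, hτ, ?_⟩
      rw [(h.lineMap_eq_toPlane hρ).2 hcq, ← hz]
      congr 1
      ring

/-- A point of a level in a triangle that lies on a proper face is a point of the 1-skeleton of
the same level. -/
lemma mem_skeletonLevel_of_mem_face (hρ : IsAllowedAction ρ) (h : IsOrderedTriangle T p q r t)
    {c : ℝ} {x : Plane}
    (hx : x ∈ convexHull ℝ (skeletonLevel T ρ c ∩ convexHull ℝ (t : Set Plane)))
    {s : Set Plane} (hs : s ⊆ t) (hne : ¬ (t : Set Plane) ⊆ s) (hxs : x ∈ convexHull ℝ s) :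
    x ∈ skeletonLevel T ρ c := by
  have hc := h.level_mem_Icc hρ (convexHull_nonempty_iff.1 ⟨x, hx⟩)
  have hsk : ({edgePoint ρ p r c, midPoint ρ p q r c} : Set Plane) ⊆ skeletonLevel T ρ c := by
    rw [← h.skeletonLevel_inter hρ hc]
    exact inter_subset_left
  obtain ⟨θ, z, rfl, hl⟩ := (h.mem_level_iff hρ hc).1 hx
  rw [h.coe_eq] at hs hne
  have hpair : ∀ {a b : Deck}, s ⊆ {pt a, pt b} →
      ∃ u : ℝ, toPlane p q r θ z = AffineMap.lineMap (pt a) (pt b) u := by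
    intro a b hab
    have := convexHull_mono hab hxs
    rw [convexHull_pair, segment_eq_image_lineMap] at this
    obtain ⟨u, -, hu⟩ := this
    exact ⟨u, hu.symm⟩
  -- A proper face misses a vertex, so the corresponding barycentric coordinate vanishes.
  have hb : θ = 0 ∨ z = 0 ∨ θ + z = 1 := by
    have hmiss : pt p ∉ s ∨ pt q ∉ s ∨ pt r ∉ s := by
      by_contra! hall
      refine hne ?_
      rintro x (rfl | rfl | rfl)
      exacts [hall.1, hall.2.1, hall.2.2]
    rcases hmiss with hm | hm | hm
    · obtain ⟨u, hu⟩ := hpair (a := q) (b := r) fun y hy => by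
        rcases hs hy with rfl | hy' | hy'
        exacts [absurd hy hm, Or.inl hy', Or.inr hy']
      right; right
      have := h.toPlane_inj (hu.trans (show _ = toPlane p q r (1 - u) u by
        simp only [AffineMap.lineMap_apply, toPlane, vsub_eq_sub, vadd_eq_add]
        module))
      linarith [this.1, this.2]
    · obtain ⟨u, hu⟩ := hpair (a := p) (b := r) fun y hy => by
        rcases hs hy with hy' | rfl | hy'
        exacts [Or.inl hy', absurd hy hm, Or.inr hy']
      left
      exact (h.toPlane_inj (hu.trans (show _ = toPlane p q r 0 u by
        simp only [AffineMap.lineMap_apply, toPlane, vsub_eq_sub, vadd_eq_add]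
        module))).1
    · obtain ⟨u, hu⟩ := hpair (a := p) (b := q) fun y hy => by
        rcases hs hy with hy' | hy' | rfl
        exacts [Or.inl hy', Or.inr hy', absurd hy hm]
      right; left
      exact (h.toPlane_inj (hu.trans (show _ = toPlane p q r u 0 by
        simp only [AffineMap.lineMap_apply, toPlane, vsub_eq_sub, vadd_eq_add]
        module))).2
  apply hsk
  rcases (h.sweep hρ).boundary hc hl hb with ⟨rfl, rfl⟩ | ⟨hcq, rfl, rfl⟩ | ⟨hcq, rfl, rfl⟩
  · left
    rw [edgePoint_eq_toPlane_long ρ p q r]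
  · right
    rw [midPoint_of_le hcq, edgePoint_eq_toPlane_low ρ p q r]
    rfl
  · right
    rw [h.midPoint_of_ge hρ hcq, edgePoint_eq_toPlane_high ρ p q r]
    rfl

end IsOrderedTriangle

open IsOrderedTriangle

/-- The levels of the triangles are disjoint. -/
lemma level_unique (hρ : IsAllowedAction ρ) {t t' : Finset Plane} (ht : T.IsTriangle t)
    (ht' : T.IsTriangle t') {c c' : ℝ} {x : Plane}
    (hx : x ∈ convexHull ℝ (skeletonLevel T ρ c ∩ convexHull ℝ (t : Set Plane)))
    (hx' : x ∈ convexHull ℝ (skeletonLevel T ρ c' ∩ convexHull ℝ (t' : Set Plane))) :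
    c = c' := by
  obtain ⟨p, q, r, h⟩ := ht.exists_isOrderedTriangle
  obtain ⟨p', q', r', h'⟩ := ht'.exists_isOrderedTriangle
  by_cases htt : t = t'
  · subst htt
    have hc := h.level_mem_Icc hρ (convexHull_nonempty_iff.1 ⟨x, hx⟩)
    have hc' := h.level_mem_Icc hρ (convexHull_nonempty_iff.1 ⟨x, hx'⟩)
    obtain ⟨θ, z, rfl, hl⟩ := (h.mem_level_iff hρ hc).1 hx
    obtain ⟨θ', z', he, hl'⟩ := (h.mem_level_iff hρ hc').1 hx'
    obtain ⟨rfl, rfl⟩ := h.toPlane_inj he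
    exact le_antisymm ((h.sweep hρ).le_of_le hc hc' hl hl' le_rfl)
      ((h.sweep hρ).le_of_le hc' hc hl' hl le_rfl)
  -- Distinct triangles meet in a proper face of each, where both levels are levels of the
  -- 1-skeleton.
  · have hm : x ∈ convexHull ℝ ((t : Set Plane) ∩ t') :=
      T.complex.inter_subset_convexHull h.mem h'.mem
        ⟨convexHull_min inter_subset_right (convex_convexHull ℝ _) hx,
          convexHull_min inter_subset_right (convex_convexHull ℝ _) hx'⟩
    refine hρ.skeletonLevel_unique
      (h.mem_skeletonLevel_of_mem_face hρ hx inter_subset_left (fun hsub => htt ?_) hm)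
      (h'.mem_skeletonLevel_of_mem_face hρ hx' inter_subset_right (fun hsub => htt ?_) hm)
    · exact Finset.eq_of_subset_of_card_le (Finset.coe_subset.1 (hsub.trans inter_subset_right))
        (by rw [ht.2, ht'.2])
    · exact (Finset.eq_of_subset_of_card_le (Finset.coe_subset.1 (hsub.trans inter_subset_left))
        (by rw [ht.2, ht'.2])).symm

lemma definingFunction_eq (hρ : IsAllowedAction ρ) {t : Finset Plane} (ht : T.IsTriangle t)
    {c : ℝ} {x : Plane}
    (hx : x ∈ convexHull ℝ (skeletonLevel T ρ c ∩ convexHull ℝ (t : Set Plane))) :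
    definingFunction T ρ x = c := by
  obtain ⟨t', ht', hx'⟩ := Classical.epsilon_spec (p := fun c : ℝ => ∃ t : Finset Plane,
    T.IsTriangle t ∧ x ∈ convexHull ℝ (skeletonLevel T ρ c ∩ convexHull ℝ (t : Set Plane)))
    ⟨c, t, ht, hx⟩
  exact level_unique hρ ht' ht hx' hx

namespace IsOrderedTriangle

variable {p q r : Deck} {t : Finset Plane}

lemma exists_level (hρ : IsAllowedAction ρ) (h : IsOrderedTriangle T p q r t) {x : Plane}
    (hx : x ∈ convexHull ℝ (t : Set Plane)) : ∃ c ∈ Icc (ρ p 0) (ρ r 0),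
      x ∈ convexHull ℝ (skeletonLevel T ρ c ∩ convexHull ℝ (t : Set Plane)) := by
  obtain ⟨θ, z, hθ, hz, hs, rfl⟩ := h.mem_convexHull.1 hx
  obtain ⟨c, hc, hl⟩ := (h.sweep hρ).exists_level hθ hz hs
  exact ⟨c, hc, (h.mem_level_iff hρ hc).2 ⟨θ, z, rfl, hl⟩⟩

lemma definingFunction_mem (hρ : IsAllowedAction ρ) (h : IsOrderedTriangle T p q r t) {x : Plane}
    (hx : x ∈ convexHull ℝ (t : Set Plane)) :
    definingFunction T ρ x ∈ Icc (ρ p 0) (ρ r 0) ∧ x ∈ convexHull ℝ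
      (skeletonLevel T ρ (definingFunction T ρ x) ∩ convexHull ℝ (t : Set Plane)) := by
  obtain ⟨c, hc, hl⟩ := h.exists_level hρ hx
  rw [definingFunction_eq hρ h.isTriangle hl]
  exact ⟨hc, hl⟩

/-- The defining function is strictly increasing in the direction of the edge from the smallest to
the largest vertex of a triangle. -/
lemma definingFunction_lt (hρ : IsAllowedAction ρ) (h : IsOrderedTriangle T p q r t) {θ z z' : ℝ}
    (hθ : 0 ≤ θ) (hz : 0 ≤ z) (hzz : z < z') (hz' : θ + z' ≤ 1) :
    definingFunction T ρ (toPlane p q r θ z) < definingFunction T ρ (toPlane p q r θ z') := by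
  obtain ⟨hc, hl⟩ := h.definingFunction_mem hρ (x := toPlane p q r θ z)
    (h.mem_convexHull.2 ⟨θ, z, hθ, hz, by linarith, rfl⟩)
  obtain ⟨hc', hl'⟩ := h.definingFunction_mem hρ (x := toPlane p q r θ z')
    (h.mem_convexHull.2 ⟨θ, z', hθ, by linarith, hz', rfl⟩)
  obtain ⟨θ₁, z₁, he, hl⟩ := (h.mem_level_iff hρ hc).1 hl
  obtain ⟨θ₂, z₂, he', hl'⟩ := (h.mem_level_iff hρ hc').1 hl'
  obtain ⟨rfl, rfl⟩ := h.toPlane_inj he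
  obtain ⟨rfl, rfl⟩ := h.toPlane_inj he'
  refine lt_of_le_of_ne ((h.sweep hρ).le_of_le hc hc' hl hl' hzz.le) fun heq => ?_
  rw [← heq] at hl'
  exact hzz.ne ((h.sweep hρ).eq_of_level hc hl hl')

/-- `Φ` parametrises the triangle by level and position on the level segment, and the defining
function recovers the level. The preimage of a closed set is thus the image of a compact set under
`Φ`. -/
lemma continuousOn_definingFunction (hρ : IsAllowedAction ρ) (h : IsOrderedTriangle T p q r t) :
    ContinuousOn (definingFunction T ρ) (convexHull ℝ (t : Set Plane)) := by
  let Φ : ℝ × ℝ → Plane := fun y =>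
    AffineMap.lineMap (edgePoint ρ p r y.1) (midPoint ρ p q r y.1) y.2
  have hΦ : Continuous Φ := by
    have h1 := hρ.edgePoint_continuous p r
    have h2 := h.midPoint_continuous hρ
    simp only [Φ, AffineMap.lineMap_apply, vsub_eq_sub, vadd_eq_add]
    fun_prop
  rw [continuousOn_iff_isClosed]
  intro C hC
  refine ⟨Φ '' ((Icc (ρ p 0) (ρ r 0) ∩ C) ×ˢ Icc 0 1),
    (((isCompact_Icc.inter_right hC).prod isCompact_Icc).image hΦ).isClosed, ?_⟩
  ext x
  constructor
  · rintro ⟨hxC, hx⟩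
    obtain ⟨hc, hl⟩ := h.definingFunction_mem hρ hx
    obtain ⟨τ, hτ, he⟩ := (h.mem_level_iff_exists_lineMap hρ hc).1 hl
    exact ⟨⟨(_, τ), ⟨⟨hc, hxC⟩, hτ⟩, he.symm⟩, hx⟩
  · rintro ⟨⟨⟨c, τ⟩, ⟨⟨hc, hcC⟩, hτ⟩, rfl⟩, hx⟩
    refine ⟨?_, hx⟩
    have : definingFunction T ρ (Φ (c, τ)) = c := definingFunction_eq hρ h.isTriangle
      ((h.mem_level_iff_exists_lineMap hρ hc).2 ⟨τ, hτ, rfl⟩)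
    rw [mem_preimage, this]
    exact hcC

end IsOrderedTriangle

end Triangles

/-! ### Every one-vertex triangulation is generated by two triangles. -/

section Structure

open Set

instance : Countable Deck := inferInstanceAs (Countable (ℤ × ℤ))

lemma OneVertexTriangulation.faces_countable (T : OneVertexTriangulation) :
    T.complex.faces.Countable := by
  classical
  refine (countable_range fun s : Finset Deck => s.image pt).mono fun s hs => ?_
  have hsub : (s : Set Plane) ⊆ range pt := fun x hx => mem_range_pt_of_mem_face hs hx
  obtain ⟨u, hu⟩ := Set.subset_range_iff_exists_image_eq.1 hsub
  have hfin : u.Finite := Finite.of_finite_image (hu ▸ s.finite_toSet) pt_injective.injOn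
  refine ⟨hfin.toFinset, ?_⟩
  rw [← Finset.coe_inj]
  simpa using hu

lemma OneVertexTriangulation.card_le_three (T : OneVertexTriangulation) {s : Finset Plane}
    (hs : s ∈ T.complex.faces) : s.card ≤ 3 := by
  have := (T.complex.indep hs).card_le_finrank_succ.trans
    (Nat.add_le_add_right (Submodule.finrank_le _) 1)
  simpa using this

/-- Without triangles the plane would be a countable union of points and segments, which has measure
zero. -/
lemma OneVertexTriangulation.exists_isTriangle (T : OneVertexTriangulation) :
    ∃ t, T.IsTriangle t := by
  by_contra! hno
  have hnull : ∀ s ∈ T.complex.faces,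
      MeasureTheory.volume (convexHull ℝ (s : Set Plane)) = 0 := by
    intro s hs
    have hcard : s.card ≤ 2 := by
      have h1 := T.card_le_three hs
      have h2 : s.card ≠ 3 := fun h => hno s ⟨hs, h⟩
      omega
    refine MeasureTheory.measure_mono_null (convexHull_subset_affineSpan _)
      (MeasureTheory.Measure.addHaar_affineSubspace _ _ fun htop => ?_)
    have hne : Nonempty s := (T.complex.nonempty_of_mem_faces hs).to_subtype
    have h1 := finrank_vectorSpan_range_add_one_le ℝ ((↑) : s → Plane)
    rw [Subtype.range_coe_subtype, Fintype.card_coe] at h1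
    have h2 : vectorSpan ℝ {x | x ∈ s} = ⊤ :=
      AffineSubspace.vectorSpan_eq_top_of_affineSpan_eq_top ℝ Plane Plane htop
    rw [h2, finrank_top, (by simp : Module.finrank ℝ Plane = 2)] at h1
    omega
  have huniv : MeasureTheory.volume (univ : Set Plane) = 0 := by
    rw [← T.space_eq, Geometry.SimplicialComplex.space]
    exact (MeasureTheory.measure_biUnion_null_iff T.faces_countable).2 hnull
  exact NeZero.ne (MeasureTheory.volume : MeasureTheory.Measure Plane)
    (MeasureTheory.Measure.measure_univ_eq_zero.1 huniv)

lemma OneVertexTriangulation.coe_map_addRight (s : Finset Plane) (v : Plane) :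
    ((s.map (Equiv.addRight v).toEmbedding : Finset Plane) : Set Plane) = (· + v) '' s := by
  simp

/-- A face of a simplicial complex contains no point of the relative interior of a segment from a
point of a second face to a vertex of the second face that the first one does not have. -/
lemma notMem_convexHull_of_vertex {K : Geometry.SimplicialComplex ℝ Plane} {s ε : Finset Plane}
    (hs : s ∈ K.faces) (hε : ε ∈ K.faces) {x v : Plane} (hx : x ∈ convexHull ℝ (s : Set Plane))
    (hv : v ∈ s) (hvε : v ∉ ε) {u : ℝ} (hu : 0 < u) (hu1 : u ≤ 1) :
    AffineMap.lineMap x v u ∉ convexHull ℝ (ε : Set Plane) := by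
  intro hy
  have hys : AffineMap.lineMap x v u ∈ convexHull ℝ (s : Set Plane) :=
    (convex_convexHull ℝ _).lineMap_mem hx (subset_convexHull ℝ _ hv) ⟨hu.le, hu1⟩
  have hy2 : AffineMap.lineMap x v u ∈ convexHull ℝ ((s : Set Plane) \ {v}) :=
    convexHull_mono (fun z hz => mem_sdiff_singleton.2 ⟨hz.1, fun h : z = v => hvε (h ▸ hz.2)⟩)
      (K.inter_subset_convexHull hs hε ⟨hys, hy⟩)
  have hne : ((s : Set Plane) \ {v}).Nonempty := convexHull_nonempty_iff.1 ⟨_, hy2⟩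
  have hins : (s : Set Plane) = insert v ((s : Set Plane) \ {v}) := by
    rw [insert_sdiff_singleton, insert_eq_of_mem (Finset.mem_coe.2 hv)]
  rw [hins, convexHull_insert hne] at hx
  simp only [mem_convexJoin, mem_singleton_iff, exists_eq_left, segment_eq_image_lineMap] at hx
  -- Both `z` and the point at parameter `u` lie in the affine span of `s` without `v`. The weight
  -- of `v` in that point relative to `z` is `(1 - u) * (1 - w) + u > 0`, so `v` lies in this span
  -- too, against affine independence.
  obtain ⟨z, hz, w, hw, rfl⟩ := hx
  have hz' := convexHull_subset_affineSpan _ hz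
  have hy' := convexHull_subset_affineSpan _ hy2
  have hκ : 0 < (1 - u) * (1 - w) + u := by
    have := mul_nonneg (sub_nonneg.2 hu1) (sub_nonneg.2 hw.2)
    linarith
  have hmem := AffineMap.lineMap_mem (((1 - u) * (1 - w) + u)⁻¹) hz' hy'
  have hveq : AffineMap.lineMap z (AffineMap.lineMap (AffineMap.lineMap v z w) v u)
      (((1 - u) * (1 - w) + u)⁻¹) = v := by
    have h1 : AffineMap.lineMap (AffineMap.lineMap v z w) v u =
        z + ((1 - u) * (1 - w) + u) • (v - z) := by
      simp only [AffineMap.lineMap_apply, vsub_eq_sub, vadd_eq_add]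
      module
    rw [h1]
    simp only [AffineMap.lineMap_apply, vsub_eq_sub, vadd_eq_add, add_sub_cancel_left, smul_smul,
      inv_mul_cancel₀ hκ.ne', one_smul, sub_add_cancel]
  rw [hveq] at hmem
  have hnot := (K.indep hs).notMem_affineSpan_sdiff ⟨v, hv⟩ univ
  apply hnot
  convert hmem using 2
  ext z
  simp
  tauto

variable [LinearOrder Deck] [IsOrderedAddMonoid Deck] {ρ : Deck → ℝ → ℝ}
  {T : OneVertexTriangulation}

namespace IsOrderedTriangle

variable {p q r : Deck} {t : Finset Plane}

lemma translate (h : IsOrderedTriangle T p q r t) (g : Deck) :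
    IsOrderedTriangle T (p + g) (q + g) (r + g) (t.map (Equiv.addRight (pt g)).toEmbedding) where
  lt₁ := add_lt_add_left h.lt₁ g
  lt₂ := add_lt_add_left h.lt₂ g
  mem := T.invariant g t h.mem
  coe_eq := by
    rw [OneVertexTriangulation.coe_map_addRight, h.coe_eq]
    simp [image_insert_eq, pt_add]

lemma eq_of_mem_convexHull (h : IsOrderedTriangle T p q r t) {g : Deck}
    (hg : pt g ∈ convexHull ℝ (t : Set Plane)) : g = p ∨ g = q ∨ g = r := by
  have hv : pt g ∈ T.complex.vertices := by
    rw [T.vertices_eq]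
    exact ⟨g, rfl⟩
  have := (Geometry.SimplicialComplex.vertex_mem_convexHull_iff hv h.mem).1 hg
  rw [← Finset.mem_coe, h.coe_eq] at this
  exact this.imp (fun h => pt_injective h)
    (fun h => h.imp (fun h => pt_injective h) (fun h => pt_injective h))

/-- The edge vectors of a triangle generate the group. -/
lemma exists_zsmul_add_zsmul {a b : Deck} (h : IsOrderedTriangle T 0 a (a + b) t) (g : Deck) :
    ∃ m n : ℤ, g = m • a + n • b := by
  have hlin : ∀ {α β : ℝ}, α • pt a + β • pt (a + b) = 0 → α = 0 ∧ β = 0 := fun {α β} he =>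
    h.linearIndependent (by simpa [pt_zero] using he)
  have hhull : ∀ {k : Deck} {α β : ℝ}, pt k = α • pt a + β • pt (a + b) → 0 ≤ α → 0 ≤ β →
      α + β ≤ 1 → (α = 0 ∧ β = 0) ∨ (α = 1 ∧ β = 0) ∨ (α = 0 ∧ β = 1) := by
    intro k α β hk hα hβ hs
    rcases h.eq_of_mem_convexHull (h.mem_convexHull.2 ⟨α, β, hα, hβ, hs, by
      rw [hk, toPlane, pt_zero]; module⟩) with rfl | rfl | rfl
    · exact Or.inl (hlin (by rw [← hk, pt_zero]))
    · have := hlin (α := α - 1) (β := β) (by rw [sub_smul, one_smul]; nth_rw 2 [hk]; module)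
      exact Or.inr (Or.inl ⟨by linarith, this.2⟩)
    · have := hlin (α := α) (β := β - 1) (by
        have e : (α • pt a + β • pt (a + b)) - pt (a + b) = 0 := by rw [← hk, sub_self]
        rw [← e]; module)
      exact Or.inr (Or.inr ⟨this.1, by linarith⟩)
  obtain ⟨α, β, hg⟩ : ∃ α β : ℝ, pt g = α • pt a + β • pt (a + b) := by
    have hli : LinearIndependent ℝ ![pt a, pt (a + b)] := LinearIndependent.pair_iff.2
      fun s t he => hlin he
    have htop := hli.span_eq_top_of_card_eq_finrank' (by simp)
    have : pt g ∈ Submodule.span ℝ (range ![pt a, pt (a + b)]) := htop ▸ Submodule.mem_top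
    simp only [Matrix.range_cons, Matrix.range_empty, union_empty, singleton_union,
      Submodule.mem_span_pair] at this
    obtain ⟨α, β, he⟩ := this
    exact ⟨α, β, he.symm⟩
  -- `k` is a lattice point of the half-open parallelogram. It or its reflection `a + (a + b) - k`
  -- lies in the triangle, whose only lattice points are its vertices.
  set k := g - ⌊α⌋ • a - ⌊β⌋ • (a + b) with hk
  have hkpt : pt k = Int.fract α • pt a + Int.fract β • pt (a + b) := by
    rw [hk, pt_sub, pt_sub, pt_zsmul, pt_zsmul, hg, Int.fract, Int.fract]
    module
  have hk0 : k = 0 := by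
    have h1 := Int.fract_nonneg α
    have h2 := Int.fract_nonneg β
    have h3 := Int.fract_lt_one α
    have h4 := Int.fract_lt_one β
    rcases le_or_gt (Int.fract α + Int.fract β) 1 with hle | hgt
    · rcases hhull hkpt h1 h2 hle with ⟨e1, e2⟩ | ⟨e1, e2⟩ | ⟨e1, e2⟩
      · apply pt_injective
        rw [hkpt, e1, e2, pt_zero]
        simp
      · linarith
      · linarith
    · rcases hhull (k := a + (a + b) - k) (α := 1 - Int.fract α) (β := 1 - Int.fract β)
        (by rw [pt_sub, pt_add a (a + b), hkpt]; module) (by linarith) (by linarith)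
        (by linarith) with ⟨e1, e2⟩ | ⟨e1, e2⟩ | ⟨e1, e2⟩ <;> linarith
  refine ⟨⌊α⌋ + ⌊β⌋, ⌊β⌋, ?_⟩
  rw [hk0] at hk
  have : g = ⌊α⌋ • a + ⌊β⌋ • (a + b) := by
    rw [← sub_eq_zero, hk]
    abel
  rw [this, smul_add, add_smul]
  abel

/-- The triangle on the other side of the long edge of a triangle. -/
lemma exists_opposite {a b : Deck} (ha : 0 < a) (hb : 0 < b)
    (h : IsOrderedTriangle T 0 a (a + b) t) : ∃ t', IsOrderedTriangle T 0 b (a + b) t' := by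
  classical
  have hlin : ∀ {α β : ℝ}, α • pt b + β • pt (a + b) = 0 → α = 0 ∧ β = 0 := by
    intro α β he
    have := h.linearIndependent (α := -α) (β := α + β) (by
      rw [← he, pt_zero, pt_add]
      module)
    exact ⟨by linarith, by linarith⟩
  have hinj : ∀ {α β α' β' : ℝ}, α • pt b + β • pt (a + b) = α' • pt b + β' • pt (a + b) →
      α = α' ∧ β = β' := by
    intro α β α' β' he
    have := hlin (α := α - α') (β := β - β') (by
      rw [← sub_eq_zero] at he
      rw [← he]
      module)
    exact ⟨by linarith, by linarith⟩
  -- All three sides of the expected triangle are already edges of the complex: one side of the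
  -- given triangle and translates of the other two.
  obtain ⟨ε₁, hε₁, hε₁'⟩ := h.isEdge (v := 0) (w := a + b) (by simp) (by simp)
  obtain ⟨ε₂, hε₂, hε₂'⟩ := (h.translate (-a)).isEdge (v := 0) (w := b) (by simp)
    (by simp)
  obtain ⟨ε₃, hε₃, hε₃'⟩ := (h.translate b).isEdge (v := b) (w := a + b) (by simp) (by simp)
  -- The centroid of the expected triangle. A face containing it cannot have a vertex outside that
  -- triangle, as the segment to such a vertex would cross one of the three sides.
  set x : Plane := (1 / 3 : ℝ) • pt b + (1 / 3 : ℝ) • pt (a + b) with hx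
  obtain ⟨s, hs, hxs⟩ := Geometry.SimplicialComplex.mem_space_iff.1
    (T.space_eq ▸ mem_univ x : x ∈ T.complex.space)
  have hsub : (s : Set Plane) ⊆ {pt 0, pt b, pt (a + b)} := by
    intro v hv
    by_contra hvn
    obtain ⟨g, rfl⟩ := mem_range_pt_of_mem_face hs hv
    obtain ⟨m, n, rfl⟩ := h.exists_zsmul_add_zsmul g
    have hvn' : ∀ k : Deck, (k = 0 ∨ k = b ∨ k = a + b) → m • a + n • b ≠ k := by
      rintro k hk rfl
      rcases hk with hk | hk | hk <;> exact hvn (by rw [hk]; simp)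
    have hcoord : ∀ u : ℝ, AffineMap.lineMap x (pt (m • a + n • b)) u =
        ((1 - u) / 3 + u * (n - m)) • pt b + ((1 - u) / 3 + u * m) • pt (a + b) := by
      intro u
      simp only [AffineMap.lineMap_apply, hx, pt_add, pt_zsmul, vsub_eq_sub, vadd_eq_add]
      module
    have hvε : ∀ {ε : Finset Plane}, (ε : Set Plane) ⊆ {pt 0, pt b, pt (a + b)} →
        pt (m • a + n • b) ∉ ε := fun hε hm => hvn (hε hm)
    -- `n - m`, `m` and `1 - n` are the barycentric coordinates of the foreign vertex. They are
    -- integers with sum `1`, so if none is negative it is a vertex of the triangle.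
    have hneg : n - m < 0 ∨ m < 0 ∨ 1 - n < 0 := by
      by_contra! hcon
      obtain ⟨h1, h2, h3⟩ := hcon
      have : (m = 0 ∧ n = 0) ∨ (m = 0 ∧ n = 1) ∨ (m = 1 ∧ n = 1) := by omega
      rcases this with ⟨rfl, rfl⟩ | ⟨rfl, rfl⟩ | ⟨rfl, rfl⟩
      · exact hvn' 0 (by simp) (by simp)
      · exact hvn' b (by simp) (by simp)
      · exact hvn' (a + b) (by simp) (by simp)
    have hmin : (n - m < 0 ∧ n - m ≤ m ∧ n - m ≤ 1 - n) ∨ (m < 0 ∧ m ≤ n - m ∧ m ≤ 1 - n) ∨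
        (1 - n < 0 ∧ 1 - n ≤ n - m ∧ 1 - n ≤ m) := by omega
    -- On the way from the centroid the smallest coordinate `k` reaches zero first, at `u = 1 / (1 -
    -- 3 * k)`, while the other two are still nonnegative: the path is then on a side.
    have key : ∀ {k l j : ℤ}, k < 0 → k ≤ l → k ≤ j → l + k + j = 1 → ∃ u : ℝ, 0 < u ∧ u ≤ 1 ∧
        (1 - u) / 3 + u * k = 0 ∧ 0 ≤ (1 - u) / 3 + u * l ∧ 0 ≤ (1 - u) / 3 + u * j ∧
        ((1 - u) / 3 + u * l) + ((1 - u) / 3 + u * j) = 1 := by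
      intro k l j hk hl hj hs
      have hk' : (k : ℝ) < 0 := by exact_mod_cast hk
      have hl' : (k : ℝ) ≤ l := by exact_mod_cast hl
      have hj' : (k : ℝ) ≤ j := by exact_mod_cast hj
      have hs' : (l : ℝ) + k + j = 1 := by exact_mod_cast hs
      have hpos : 0 < 1 / (1 - 3 * (k : ℝ)) := by
        apply div_pos one_pos
        linarith
      have he : (1 - 1 / (1 - 3 * (k : ℝ))) / 3 + 1 / (1 - 3 * (k : ℝ)) * k = 0 := by
        field_simp [(by linarith : (1 - 3 * (k : ℝ)) ≠ 0)]
        ring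
      refine ⟨1 / (1 - 3 * k), hpos, (div_le_one (by linarith)).2 (by linarith), he, ?_, ?_, ?_⟩
      · nlinarith
      · nlinarith
      · have : (j : ℝ) = 1 - k - l := by linarith
        rw [this]
        linarith
    rcases hmin with ⟨h1, h2, h3⟩ | ⟨h1, h2, h3⟩ | ⟨h1, h2, h3⟩
    · obtain ⟨u, hu, hu1, e1, e2, e3, e4⟩ := key h1 h2 h3 (by ring)
      push_cast at e1 e2 e3 e4
      refine notMem_convexHull_of_vertex hs hε₁ hxs hv (hvε ?_) hu hu1 ?_
      · rw [hε₁']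
        rintro y (rfl | rfl) <;> simp
      · rw [hε₁', convexHull_pair, hcoord, e1, segment_eq_image_lineMap]
        refine ⟨(1 - u) / 3 + u * m, ⟨e2, by linarith⟩, ?_⟩
        simp [AffineMap.lineMap_apply, pt_zero]
    · obtain ⟨u, hu, hu1, e1, e2, e3, e4⟩ := key h1 h2 h3 (by ring)
      push_cast at e1 e2 e3 e4
      refine notMem_convexHull_of_vertex hs hε₂ hxs hv (hvε ?_) hu hu1 ?_
      · rw [hε₂']
        rintro y (rfl | rfl) <;> simp
      · rw [hε₂', convexHull_pair, hcoord, e1, segment_eq_image_lineMap]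
        refine ⟨(1 - u) / 3 + u * (n - m), ⟨e2, by linarith⟩, ?_⟩
        simp [AffineMap.lineMap_apply, pt_zero]
    · obtain ⟨u, hu, hu1, e1, e2, e3, e4⟩ := key h1 h2 h3 (by ring)
      push_cast at e1 e2 e3 e4
      refine notMem_convexHull_of_vertex hs hε₃ hxs hv (hvε ?_) hu hu1 ?_
      · rw [hε₃']
        rintro y (rfl | rfl) <;> simp
      · rw [hε₃', convexHull_pair, hcoord, segment_eq_image_lineMap]
        refine ⟨(1 - u) / 3 + u * m, ⟨e3, by linarith⟩, ?_⟩
        rw [(by linarith : (1 - u) / 3 + u * ((n : ℝ) - m) = 1 - ((1 - u) / 3 + u * m))]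
        simp only [AffineMap.lineMap_apply, vsub_eq_sub, vadd_eq_add]
        module
  have hpair : ∀ {v w : Deck}, (s : Set Plane) ⊆ {pt v, pt w} →
      ∃ u : ℝ, x = (1 - u) • pt v + u • pt w := by
    intro v w hvw
    have := convexHull_mono hvw hxs
    rw [convexHull_pair, segment_eq_image_lineMap] at this
    obtain ⟨u, -, hu⟩ := this
    refine ⟨u, hu.symm.trans ?_⟩
    simp only [AffineMap.lineMap_apply, vsub_eq_sub, vadd_eq_add]
    module
  refine ⟨s, hb, lt_add_of_pos_left _ ha, hs, hsub.antisymm ?_⟩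
  rintro v (rfl | rfl | rfl) <;> by_contra hm
  · obtain ⟨u, hu⟩ := hpair (v := b) (w := a + b) fun y hy => by
      rcases hsub hy with rfl | hy' | hy'
      exacts [absurd hy hm, Or.inl hy', Or.inr hy']
    have := hinj hu
    linarith [this.1, this.2]
  · obtain ⟨u, hu⟩ := hpair (v := 0) (w := a + b) fun y hy => by
      rcases hsub hy with hy' | rfl | hy'
      exacts [Or.inl hy', absurd hy hm, Or.inr hy']
    have := hinj (α' := 0) (β' := u) (hu.trans (by simp [pt_zero]))
    linarith [this.1]
  · obtain ⟨u, hu⟩ := hpair (v := 0) (w := b) fun y hy => by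
      rcases hsub hy with hy' | hy' | rfl
      exacts [Or.inl hy', Or.inr hy', absurd hy hm]
    have := hinj (α' := u) (β' := 0) (hu.trans (by simp [pt_zero]))
    linarith [this.2]

end IsOrderedTriangle

/-- The triangulation consists of the translates of two triangles with a common long edge `a + b`,
where `a` and `b` are positive generators of the group. -/
structure IsGeneratedBy (T : OneVertexTriangulation) (a b : Deck) : Prop where
  pos_left : 0 < a
  pos_right : 0 < b
  triangle : ∃ t, IsOrderedTriangle T 0 a (a + b) t
  opposite : ∃ t, IsOrderedTriangle T 0 b (a + b) t
  generate : ∀ g, ∃ m n : ℤ, g = m • a + n • b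

theorem OneVertexTriangulation.exists_isGeneratedBy (T : OneVertexTriangulation) :
    ∃ a b : Deck, IsGeneratedBy T a b := by
  obtain ⟨t, ht⟩ := T.exists_isTriangle
  obtain ⟨p, q, r, h⟩ := ht.exists_isOrderedTriangle
  obtain ⟨t', h'⟩ : ∃ t', IsOrderedTriangle T 0 (q - p) (q - p + (r - q)) t' := by
    have := h.translate (-p)
    rw [add_neg_cancel, ← sub_eq_add_neg, ← sub_eq_add_neg,
      (by abel : r - p = q - p + (r - q))] at this
    exact ⟨_, this⟩
  exact ⟨q - p, r - q, sub_pos.2 h.lt₁, sub_pos.2 h.lt₂, ⟨_, h'⟩,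
    h'.exists_opposite (sub_pos.2 h.lt₁) (sub_pos.2 h.lt₂), h'.exists_zsmul_add_zsmul⟩

end Structure

/-! ### Equivariance of the defining function; level sets as graphs. -/

section Levels

open Set Filter Topology

open scoped Pointwise

lemma strictMono_of_strictMonoOn_Icc_int {f : ℝ → ℝ}
    (h : ∀ n : ℤ, StrictMonoOn f (Icc (n : ℝ) (n + 1))) : StrictMono f := by
  have hnat : ∀ (n : ℤ) (k : ℕ), StrictMonoOn f (Icc (n : ℝ) (n + (k + 1))) := by
    intro n k
    induction k with
    | zero => simpa using h n
    | succ k ih =>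
      have h2 := h (n + (k + 1))
      push_cast at h2
      have h3 := ih.union (c := (n : ℝ) + (k + 1)) h2
        (isGreatest_Icc (by linarith [(Nat.cast_nonneg k : (0 : ℝ) ≤ k)]))
        (isLeast_Icc (by linarith))
      rw [Icc_union_Icc_eq_Icc (by linarith [(Nat.cast_nonneg k : (0 : ℝ) ≤ k)])
        (by linarith)] at h3
      push_cast
      rwa [← add_assoc (n : ℝ)]
  intro x y hxy
  obtain ⟨k, hk⟩ := exists_nat_gt (y - x)
  exact hnat ⌊x⌋ k ⟨Int.floor_le x, by linarith [Int.lt_floor_add_one x,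
    (Nat.cast_nonneg k : (0 : ℝ) ≤ k)]⟩ ⟨(Int.floor_le x).trans hxy.le, by
      linarith [Int.lt_floor_add_one x]⟩ hxy

lemma locallyFinite_unit_squares :
    LocallyFinite fun k : ℤ × ℤ => Icc (k.1 : ℝ) (k.1 + 1) ×ˢ Icc (k.2 : ℝ) (k.2 + 1) := by
  have h : LocallyFinite fun n : ℤ => Icc (n : ℝ) (n + 1) :=
    locallyFinite_Icc_of_tendsto tendsto_intCast_atTop_atTop
      (tendsto_atBot_add_const_right _ _ (tendsto_intCast_atBot_iff.2 tendsto_id))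
  rintro ⟨x, y⟩
  obtain ⟨U, hU, hfU⟩ := h x
  obtain ⟨V, hV, hfV⟩ := h y
  refine ⟨U ×ˢ V, prod_mem_nhds hU hV, (hfU.prod hfV).subset ?_⟩
  rintro ⟨m, n⟩ ⟨⟨u, v⟩, ⟨hu, hv⟩, hu', hv'⟩
  exact ⟨⟨u, hu, hu'⟩, ⟨v, hv, hv'⟩⟩

lemma OneVertexTriangulation.IsEdge.translate {T : OneVertexTriangulation} {p q : Deck}
    (h : T.IsEdge p q) (g : Deck) : T.IsEdge (p + g) (q + g) := by
  obtain ⟨e, he, hes⟩ := h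
  refine ⟨_, T.invariant g e he, ?_⟩
  rw [OneVertexTriangulation.coe_map_addRight, hes]
  simp [image_insert_eq, pt_add]

lemma OneVertexTriangulation.IsTriangle.translate {T : OneVertexTriangulation} {t : Finset Plane}
    (h : T.IsTriangle t) (g : Deck) : T.IsTriangle (t.map (Equiv.addRight (pt g)).toEmbedding) :=
  ⟨T.invariant g t h.1, by rw [Finset.card_map, h.2]⟩

/-- Linear coordinates on the plane adapted to a triangulation with generators `a` and `b`. -/
def planePoint (a b : Deck) (w z : ℝ) : Plane := w • pt a + z • pt (a + b)

lemma planePoint_add (a b : Deck) (w z : ℝ) (m n : ℤ) :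
    planePoint a b (w + m) (z + n) = planePoint a b w z + pt (m • a + n • (a + b)) := by
  rw [planePoint, planePoint, pt_add (m • a), pt_zsmul, pt_zsmul]
  module

lemma planePoint_continuous (a b : Deck) :
    Continuous fun y : ℝ × ℝ => planePoint a b y.1 y.2 := by
  unfold planePoint
  fun_prop

variable [LinearOrder Deck] [IsOrderedAddMonoid Deck] {ρ : Deck → ℝ → ℝ}
  {T : OneVertexTriangulation}

lemma add_mem_skeletonLevel (hρ : IsAllowedAction ρ) {c : ℝ} {x : Plane}
    (hx : x ∈ skeletonLevel T ρ c) (g : Deck) : x + pt g ∈ skeletonLevel T ρ (ρ g c) := by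
  obtain ⟨p, q, hpq, he, u, hu, rfl, rfl⟩ := hx
  refine ⟨p + g, q + g, add_lt_add_left hpq g, he.translate g, u, hu, ?_, ?_⟩
  · simp only [AffineMap.lineMap_apply, pt_add, vsub_eq_sub, vadd_eq_add]
    module
  · rw [← hρ.map_add, add_sub_add_right_eq_sub, add_comm]

lemma definingFunction_add (hρ : IsAllowedAction ρ) {t : Finset Plane} (ht : T.IsTriangle t)
    {x : Plane} (hx : x ∈ convexHull ℝ (t : Set Plane)) (g : Deck) :
    definingFunction T ρ (x + pt g) = ρ g (definingFunction T ρ x) := by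
  obtain ⟨p, q, r, h⟩ := ht.exists_isOrderedTriangle
  obtain ⟨-, hl⟩ := h.definingFunction_mem hρ hx
  refine definingFunction_eq hρ (ht.translate g) ?_
  rw [OneVertexTriangulation.coe_map_addRight, add_comm x, ← vadd_eq_add]
  have himage : ∀ s : Set Plane, (· + pt g) '' s = pt g +ᵥ s := fun s => by
    rw [← image_vadd]
    exact image_congr fun y _ => add_comm _ _
  rw [himage, convexHull_vadd]
  have hmem : pt g +ᵥ x ∈ pt g +ᵥ convexHull ℝ
      (skeletonLevel T ρ (definingFunction T ρ x) ∩ convexHull ℝ (t : Set Plane)) :=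
    vadd_mem_vadd_set hl
  rw [← convexHull_vadd] at hmem
  refine convexHull_mono ?_ hmem
  rintro _ ⟨y, ⟨hy, hyt⟩, rfl⟩
  refine ⟨?_, vadd_mem_vadd_set hyt⟩
  simp only [vadd_eq_add]
  rw [add_comm]
  exact add_mem_skeletonLevel hρ hy g

namespace IsGeneratedBy

variable {a b : Deck}

lemma planePoint_injective (h : IsGeneratedBy T a b) {w z w' z' : ℝ}
    (he : planePoint a b w z = planePoint a b w' z') : w = w' ∧ z = z' := by
  obtain ⟨t, ht⟩ := h.triangle
  exact ht.toPlane_inj (by simpa [planePoint, IsOrderedTriangle.toPlane, pt_zero] using he)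

lemma planePoint_surjective (h : IsGeneratedBy T a b) (x : Plane) :
    ∃ w z, x = planePoint a b w z := by
  obtain ⟨t, ht⟩ := h.triangle
  have hli : LinearIndependent ℝ ![pt a, pt (a + b)] := LinearIndependent.pair_iff.2
    fun s t he => ht.linearIndependent (by simpa [pt_zero] using he)
  have htop := hli.span_eq_top_of_card_eq_finrank' (by simp)
  have : x ∈ Submodule.span ℝ (range ![pt a, pt (a + b)]) := htop ▸ Submodule.mem_top
  simp only [Matrix.range_cons, Matrix.range_empty, union_empty, singleton_union,
    Submodule.mem_span_pair] at this
  obtain ⟨w, z, he⟩ := this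
  exact ⟨w, z, he.symm⟩

/-- The unit squares in linear coordinates are unions of two triangles. -/
lemma exists_triangle_low (h : IsGeneratedBy T a b) (m n : ℤ) :
    ∃ p q r t, IsOrderedTriangle T p q r t ∧ ∀ w z : ℝ,
      planePoint a b w z = IsOrderedTriangle.toPlane p q r (w - m) (z - n) := by
  obtain ⟨t, ht⟩ := h.triangle
  refine ⟨_, _, _, _, ht.translate (m • a + n • (a + b)), fun w z => ?_⟩
  simp only [planePoint, IsOrderedTriangle.toPlane, pt_add, pt_zsmul, pt_zero]
  module

lemma exists_triangle_high (h : IsGeneratedBy T a b) (m n : ℤ) :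
    ∃ p q r t, IsOrderedTriangle T p q r t ∧ ∀ w z : ℝ,
      planePoint a b w z =
        IsOrderedTriangle.toPlane p q r (m + 1 - w) ((w - m) + (z - n) - 1) := by
  obtain ⟨t, ht⟩ := h.opposite
  refine ⟨_, _, _, _, ht.translate ((m + 1) • a + n • (a + b)), fun w z => ?_⟩
  simp only [planePoint, IsOrderedTriangle.toPlane, pt_add, pt_zsmul, pt_zero]
  push_cast
  module

lemma exists_mem_triangle (h : IsGeneratedBy T a b) (x : Plane) :
    ∃ p q r t, IsOrderedTriangle T p q r t ∧ x ∈ convexHull ℝ (t : Set Plane) := by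
  obtain ⟨w, z, rfl⟩ := h.planePoint_surjective x
  have h1 := Int.floor_le w
  have h2 := Int.lt_floor_add_one w
  have h3 := Int.floor_le z
  have h4 := Int.lt_floor_add_one z
  rcases le_total ((w - ⌊w⌋) + (z - ⌊z⌋)) 1 with hle | hle
  · obtain ⟨p, q, r, t, ht, he⟩ := h.exists_triangle_low ⌊w⌋ ⌊z⌋
    exact ⟨p, q, r, t, ht, ht.mem_convexHull.2 ⟨_, _, by linarith, by linarith, hle, he w z⟩⟩
  · obtain ⟨p, q, r, t, ht, he⟩ := h.exists_triangle_high ⌊w⌋ ⌊z⌋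
    exact ⟨p, q, r, t, ht, ht.mem_convexHull.2 ⟨_, _, by linarith, by linarith, by linarith,
      he w z⟩⟩

lemma definingFunction_add (h : IsGeneratedBy T a b) (hρ : IsAllowedAction ρ) (x : Plane)
    (g : Deck) : definingFunction T ρ (x + pt g) = ρ g (definingFunction T ρ x) := by
  obtain ⟨p, q, r, t, ht, hx⟩ := h.exists_mem_triangle x
  exact FLOiation.definingFunction_add hρ ht.isTriangle hx g

/-- The orbit of `0` under an allowed action may be bounded, and only levels between orbit points
are attained. -/
lemma definingFunction_bounded (h : IsGeneratedBy T a b) (hρ : IsAllowedAction ρ) (x : Plane) :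
    ∃ p r, ρ p 0 ≤ definingFunction T ρ x ∧ definingFunction T ρ x ≤ ρ r 0 := by
  obtain ⟨p, q, r, t, ht, hx⟩ := h.exists_mem_triangle x
  exact ⟨p, r, (ht.definingFunction_mem hρ hx).1⟩

/-- A line in the direction `a + b` is parallel to the long edges of all triangles. Over each unit
interval it crosses a translate of each of the two triangles, passing from one to the other at `n +
1 - (w - ⌊w⌋)`. -/
lemma strictMono_definingFunction (h : IsGeneratedBy T a b) (hρ : IsAllowedAction ρ) (w : ℝ) :
    StrictMono fun z => definingFunction T ρ (planePoint a b w z) := by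
  refine strictMono_of_strictMonoOn_Icc_int fun n => ?_
  have h1 := Int.floor_le w
  have h2 := Int.lt_floor_add_one w
  have hlow : StrictMonoOn (fun z => definingFunction T ρ (planePoint a b w z))
      (Icc (n : ℝ) (n + 1 - (w - ⌊w⌋))) := by
    obtain ⟨p, q, r, t, ht, he⟩ := h.exists_triangle_low ⌊w⌋ n
    intro z hz z' hz' hzz
    simp only [he]
    exact ht.definingFunction_lt hρ (by linarith) (by linarith [hz.1]) (by linarith)
      (by linarith [hz'.2])
  have hhigh : StrictMonoOn (fun z => definingFunction T ρ (planePoint a b w z))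
      (Icc (n + 1 - (w - ⌊w⌋)) (n + 1 : ℝ)) := by
    obtain ⟨p, q, r, t, ht, he⟩ := h.exists_triangle_high ⌊w⌋ n
    intro z hz z' hz' hzz
    simp only [he]
    exact ht.definingFunction_lt hρ (by linarith) (by linarith [hz.1]) (by linarith)
      (by linarith [hz'.2])
  have := hlow.union hhigh (isGreatest_Icc (by linarith)) (isLeast_Icc (by linarith))
  rwa [Icc_union_Icc_eq_Icc (by linarith) (by linarith)] at this

lemma continuous_definingFunction (h : IsGeneratedBy T a b) (hρ : IsAllowedAction ρ) :
    Continuous fun y : ℝ × ℝ => definingFunction T ρ (planePoint a b y.1 y.2) := by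
  refine locallyFinite_unit_squares.continuous ?_ (fun k => isClosed_Icc.prod isClosed_Icc) ?_
  · refine eq_univ_of_forall fun y => mem_iUnion.2 ⟨(⌊y.1⌋, ⌊y.2⌋), ?_⟩
    exact ⟨⟨Int.floor_le _, (Int.lt_floor_add_one _).le⟩,
      ⟨Int.floor_le _, (Int.lt_floor_add_one _).le⟩⟩
  · rintro ⟨m, n⟩
    set Q : Set (ℝ × ℝ) := Icc (m : ℝ) (m + 1) ×ˢ Icc (n : ℝ) (n + 1) with hQ
    have hQc : IsClosed Q := isClosed_Icc.prod isClosed_Icc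
    have hcont : Continuous fun y : ℝ × ℝ => (y.1 - m) + (y.2 - n) := by fun_prop
    have hlow : ContinuousOn (fun y : ℝ × ℝ => definingFunction T ρ (planePoint a b y.1 y.2))
        (Q ∩ {y | (y.1 - m) + (y.2 - n) ≤ 1}) := by
      obtain ⟨p, q, r, t, ht, he⟩ := h.exists_triangle_low m n
      refine (ht.continuousOn_definingFunction hρ).comp (planePoint_continuous a b).continuousOn ?_
      rintro ⟨w, z⟩ ⟨⟨hw, hz⟩, hs⟩
      exact ht.mem_convexHull.2 ⟨_, _, by linarith [hw.1], by linarith [hz.1], hs, he w z⟩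
    have hhigh : ContinuousOn (fun y : ℝ × ℝ => definingFunction T ρ (planePoint a b y.1 y.2))
        (Q ∩ {y | 1 ≤ (y.1 - m) + (y.2 - n)}) := by
      obtain ⟨p, q, r, t, ht, he⟩ := h.exists_triangle_high m n
      refine (ht.continuousOn_definingFunction hρ).comp (planePoint_continuous a b).continuousOn ?_
      rintro ⟨w, z⟩ ⟨⟨hw, hz⟩, hs⟩
      have hs' : 1 ≤ (w - m) + (z - n) := hs
      have hw2 : w ≤ m + 1 := hw.2
      have hz2 : z ≤ n + 1 := hz.2
      exact ht.mem_convexHull.2 ⟨_, _, by linarith, by linarith, by linarith, he w z⟩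
    have := hlow.union_of_isClosed hhigh (hQc.inter (isClosed_le hcont continuous_const))
      (hQc.inter (isClosed_le continuous_const hcont))
    refine this.mono fun y hy => ?_
    rcases le_total ((y.1 - m) + (y.2 - n)) 1 with hs | hs
    exacts [Or.inl ⟨hy, hs⟩, Or.inr ⟨hy, hs⟩]

/-- The multiples of `a + b` are cofinal because `a` and `b` are positive generators. Hence each
line in this direction meets every level between orbit points. -/
lemma exists_le_nsmul (h : IsGeneratedBy T a b) (g : Deck) : ∃ n : ℕ, g ≤ n • (a + b) := by
  obtain ⟨m, n, rfl⟩ := h.generate g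
  refine ⟨m.natAbs + n.natAbs, ?_⟩
  rw [smul_add, ← natCast_zsmul, ← natCast_zsmul b]
  exact add_le_add (zsmul_le_zsmul_left h.pos_left.le (by omega))
    (zsmul_le_zsmul_left h.pos_right.le (by omega))

/-- In linear coordinates each level set is the graph of a continuous function. -/
theorem exists_level_graph (h : IsGeneratedBy T a b) (hρ : IsAllowedAction ρ) {c : ℝ} {g₀ g₁ : Deck}
    (h0 : ρ g₀ 0 ≤ c) (h1 : c ≤ ρ g₁ 0) :
    ∃ φ : ℝ → ℝ, Continuous φ ∧
      ∀ w z, definingFunction T ρ (planePoint a b w z) = c ↔ z = φ w := by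
  have hm := h.strictMono_definingFunction hρ
  have hc := h.continuous_definingFunction hρ
  have hshift : ∀ (w : ℝ) (n : ℤ), definingFunction T ρ (planePoint a b w n) =
      ρ (n • (a + b)) (definingFunction T ρ (planePoint a b w 0)) := by
    intro w n
    rw [← h.definingFunction_add hρ]
    congr 1
    have := planePoint_add a b w 0 0 n
    simpa using this
  have hex : ∀ w, ∃ z, definingFunction T ρ (planePoint a b w z) = c := by
    intro w
    obtain ⟨k₀, k₁, hk₀, hk₁⟩ := h.definingFunction_bounded hρ (planePoint a b w 0)
    refine mem_range_of_exists_le_of_exists_ge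
      (hc.comp (continuous_const.prodMk continuous_id) :
        Continuous fun z => definingFunction T ρ (planePoint a b w z)) ?_ ?_
    · obtain ⟨n, hn⟩ := h.exists_le_nsmul (k₁ - g₀)
      refine ⟨((-n : ℤ) : ℝ), le_trans ?_ h0⟩
      rw [hshift]
      refine ((hρ.strictMono _).monotone hk₁).trans ?_
      rw [← hρ.map_add, hρ.orbit_le_iff, neg_smul, natCast_zsmul, neg_add_le_iff_le_add]
      exact sub_le_iff_le_add.1 hn
    · obtain ⟨n, hn⟩ := h.exists_le_nsmul (g₁ - k₀)
      refine ⟨((n : ℤ) : ℝ), h1.trans ?_⟩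
      rw [hshift]
      refine le_trans ?_ ((hρ.strictMono _).monotone hk₀)
      rw [← hρ.map_add, hρ.orbit_le_iff, natCast_zsmul]
      exact sub_le_iff_le_add.1 hn
  choose φ hφ using hex
  -- By strict monotonicity in `z`, `l < φ w` holds exactly when the defining function at `(w, l)`
  -- is below `c`, an open condition on `w`; similarly for the opposite inequality.
  refine ⟨φ, continuous_iff_continuousAt.2 fun w₀ => tendsto_order.2 ⟨fun l hl => ?_, fun l hl => ?_⟩,
    fun w z => ⟨fun he => (hm w).injective (he.trans (hφ w).symm), fun he => he ▸ hφ w⟩⟩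
  · have h2 : definingFunction T ρ (planePoint a b w₀ l) < c := by
      rw [← hφ w₀]
      exact hm w₀ hl
    have h3 := (hc.comp (continuous_id.prodMk continuous_const) : Continuous fun w =>
      definingFunction T ρ (planePoint a b w l)).continuousAt.eventually_lt continuousAt_const h2
    filter_upwards [h3] with w hw
    rw [← hφ w] at hw
    exact (hm w).lt_iff_lt.1 hw
  · have h2 : c < definingFunction T ρ (planePoint a b w₀ l) := by
      rw [← hφ w₀]
      exact hm w₀ hl
    have h3 := continuousAt_const.eventually_lt (hc.comp (continuous_id.prodMk continuous_const) :
      Continuous fun w => definingFunction T ρ (planePoint a b w l)).continuousAt h2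
    filter_upwards [h3] with w hw
    rw [← hφ w] at hw
    exact (hm w).lt_iff_lt.1 hw

end IsGeneratedBy

end Levels

/-! ### Leaves on the torus, stabilisers of levels, and closed leaves. -/

section Leaves

open Set Filter Topology

/-- A continuous injection of the line into a circle is open. -/
lemma isOpenMap_of_injective_addCircle {f : ℝ → UnitAddCircle} (hf : Continuous f)
    (hinj : Function.Injective f) : IsOpenMap f := by
  rw [isOpenMap_iff_nhds_le]
  intro t
  -- By injectivity `f` avoids `f (t + 2)` on `[t - 1, t + 1]`. The complement of that point is a
  -- chart, in which `f` becomes an injective real function, hence strictly monotone and open at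
  -- `t`.
  obtain ⟨a, ha⟩ := QuotientAddGroup.mk_surjective (f (t + 2))
  let e := AddCircle.openPartialHomeomorphCoe (1 : ℝ) a
  let F : ℝ → ℝ := fun y => e.symm (f y)
  have hmem : ∀ y ∈ Icc (t - 1) (t + 1), f y ∈ e.target := by
    intro y hy h
    have : y = t + 2 := hinj (h.trans ha)
    linarith [hy.2]
  have hFc : ContinuousOn F (Icc (t - 1) (t + 1)) :=
    e.symm.continuousOn.comp hf.continuousOn hmem
  have hF : ∀ y ∈ Icc (t - 1) (t + 1), ((F y : ℝ) : UnitAddCircle) = f y := fun y hy =>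
    e.right_inv (hmem y hy)
  have hFi : InjOn F (Icc (t - 1) (t + 1)) := by
    intro y hy z hz h
    apply hinj
    rw [← hF y hy, ← hF z hz, h]
  have hFnhds : ∀ s ∈ 𝓝 t, F '' s ∈ 𝓝 (F t) := by
    intro s hs
    obtain ⟨δ, hδ, hδs⟩ := Metric.nhds_basis_closedBall.mem_iff.1 hs
    set η := min δ 1 with hη
    have hη0 : 0 < η := lt_min hδ one_pos
    have hη1 : η ≤ 1 := min_le_right _ _
    have hηδ : η ≤ δ := min_le_left _ _
    have hsub : Icc (t - η) (t + η) ⊆ Icc (t - 1) (t + 1) :=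
      Icc_subset_Icc (by linarith) (by linarith)
    have hsub' : Icc (t - η) (t + η) ⊆ s := fun y hy => hδs (by
      rw [Real.closedBall_eq_Icc]
      exact ⟨by linarith [hy.1], by linarith [hy.2]⟩)
    have m0 : t - η ∈ Icc (t - η) (t + η) := ⟨le_rfl, by linarith⟩
    have m1 : t ∈ Icc (t - η) (t + η) := ⟨by linarith, by linarith⟩
    have m2 : t + η ∈ Icc (t - η) (t + η) := ⟨by linarith, le_rfl⟩
    rcases (hFc.mono hsub).strictMonoOn_of_injOn_Icc' (by linarith) (hFi.mono hsub) with hm | hm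
    · refine mem_of_superset (Icc_mem_nhds (hm m0 m1 (by linarith)) (hm m1 m2 (by linarith)))
        ((intermediate_value_Icc (by linarith) (hFc.mono hsub)).trans (image_mono hsub'))
    · refine mem_of_superset (Icc_mem_nhds (hm m1 m2 (by linarith)) (hm m0 m1 (by linarith)))
        ((intermediate_value_Icc' (by linarith) (hFc.mono hsub)).trans (image_mono hsub'))
  intro s hs
  have h1 := hFnhds _ (inter_mem (mem_map.1 hs)
    (Icc_mem_nhds (by linarith : t - 1 < t) (by linarith : t < t + 1)))
  have hopen : IsOpenMap ((↑) : ℝ → UnitAddCircle) := QuotientAddGroup.isOpenMap_coe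
  have h2 := hopen.image_mem_nhds h1
  rw [hF t ⟨by linarith, by linarith⟩] at h2
  refine mem_of_superset h2 ?_
  rintro _ ⟨_, ⟨y, ⟨hy, hy'⟩, rfl⟩, rfl⟩
  rw [hF y hy']
  exact hy

/-- There is no continuous bijection from the line to a circle. -/
lemma not_bijective_circle {f : ℝ → Circle} (hf : Continuous f) : ¬ Function.Bijective f := by
  intro hbij
  let e : UnitAddCircle ≃ₜ Circle := AddCircle.homeomorphCircle one_ne_zero
  let F : ℝ ≃ UnitAddCircle := (Equiv.ofBijective f hbij).trans e.symm.toEquiv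
  have hFc : Continuous F := e.symm.continuous.comp hf
  let H : ℝ ≃ₜ UnitAddCircle :=
    F.toHomeomorphOfContinuousOpen hFc (isOpenMap_of_injective_addCircle hFc F.injective)
  have := H.symm.compactSpace
  exact not_compactSpace_iff.2 inferInstance this

lemma continuous_cover : Continuous cover :=
  ((AddCircle.continuous_mk' 1).comp continuous_fst).prodMk
    ((AddCircle.continuous_mk' 1).comp continuous_snd)

lemma cover_eq_iff (x y : Plane) : cover x = cover y ↔ ∃ g : Deck, x = y + pt g := by
  have key : ∀ u v : ℝ, (u : UnitAddCircle) = v ↔ ∃ n : ℤ, u = v + n := by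
    intro u v
    rw [← sub_eq_zero, ← AddCircle.coe_sub, AddCircle.coe_eq_zero_iff]
    refine exists_congr fun n => ?_
    rw [zsmul_eq_mul, mul_one]
    constructor <;> intro h <;> linarith
  rw [cover, cover, Prod.mk.injEq, key, key]
  constructor
  · rintro ⟨⟨m, hm⟩, n, hn⟩
    exact ⟨(m, n), Prod.ext hm hn⟩
  · rintro ⟨g, rfl⟩
    exact ⟨⟨g.1, rfl⟩, g.2, rfl⟩

lemma cover_chart_eq_iff (T : OneVertexTriangulation) (x y : Plane) :
    cover (T.chart x) = cover (T.chart y) ↔ ∃ g : Deck, x = y + pt g := by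
  rw [cover_eq_iff]
  refine exists_congr fun g => ?_
  rw [← T.chart_equivariant, T.chart.injective.eq_iff]

variable [LinearOrder Deck] [IsOrderedAddMonoid Deck] {ρ : Deck → ℝ → ℝ}
  {T : OneVertexTriangulation}

namespace IsAllowedAction

lemma eq_zero_of_fixed_of_archimedean [Archimedean Deck] (hρ : IsAllowedAction ρ) {c : ℝ}
    {g₀ g₁ k : Deck} (h0 : ρ g₀ 0 ≤ c) (h1 : c ≤ ρ g₁ 0) (hk : ρ k c = c) : k = 0 := by
  have key : ∀ k : Deck, 0 < k → ρ k c ≠ c := by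
    intro k hpos hk
    have hn : ∀ n : ℕ, ρ (n • k) c = c := by
      intro n
      induction n with
      | zero => rw [zero_smul, hρ.map_zero]
      | succ n ih => rw [succ_nsmul, hρ.map_add, hk, ih]
    -- Since `n • k` fixes `c`, it keeps the orbit point of `g₀` below that of `g₁`, so `n • k ≤ g₁
    -- - g₀`. The extra `k` makes this contradictory.
    obtain ⟨n, hle⟩ := Archimedean.arch (g₁ - g₀ + k) hpos
    have h2 := (hρ.strictMono (n • k)).monotone h0
    rw [hn, ← hρ.map_add] at h2
    have h3 := (hρ.orbit_le_iff _ _).1 (h2.trans h1)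
    have h4 : g₁ - g₀ + k ≤ g₁ - g₀ := hle.trans (le_sub_iff_add_le.2 h3)
    exact absurd hpos (by simpa using h4 : k ≤ 0).not_gt
  rcases lt_trichotomy k 0 with h | h | h
  · refine absurd ?_ (key (-k) (neg_pos.2 h))
    nth_rw 1 [← hk]
    exact hρ.neg_apply k c
  · exact h
  · exact absurd hk (key k h)

/-- The orbit of `0` under the multiples of an infinitely small `k` increases to a finite limit,
which `k` fixes by continuity. -/
lemma exists_fixed_of_not_archimedean (hρ : IsAllowedAction ρ) (hA : ¬ Archimedean Deck) :
    ∃ (k : Deck) (c : ℝ) (g₀ g₁ : Deck), k ≠ 0 ∧ ρ k c = c ∧ ρ g₀ 0 ≤ c ∧ c ≤ ρ g₁ 0 := by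
  obtain ⟨x, k, hk, hx⟩ : ∃ x k : Deck, 0 < k ∧ ∀ n : ℕ, n • k < x := by
    by_contra! h
    exact hA ⟨fun x y hy => h x y hy⟩
  have hmono : Monotone fun n : ℕ => ρ (n • k) 0 := fun m n hmn =>
    (hρ.orbit_le_iff _ _).2 (nsmul_le_nsmul_left hk.le hmn)
  have hbdd : BddAbove (range fun n : ℕ => ρ (n • k) 0) :=
    ⟨ρ x 0, by rintro _ ⟨n, rfl⟩; exact (hρ.orbit_le_iff _ _).2 (hx n).le⟩
  have hlim := tendsto_atTop_ciSup hmono hbdd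
  refine ⟨k, ⨆ n : ℕ, ρ (n • k) 0, 0, x, hk.ne', ?_, ?_, ?_⟩
  · refine tendsto_nhds_unique (((hρ.continuous k).tendsto _).comp hlim) ?_
    refine (hlim.comp (tendsto_add_atTop_nat 1)).congr fun n => ?_
    simp only [Function.comp]
    rw [succ_nsmul', hρ.map_add]
  · simpa using le_ciSup hbdd 0
  · exact ciSup_le fun n => (hρ.orbit_le_iff _ _).2 (hx n).le

end IsAllowedAction

namespace IsGeneratedBy

variable {a b : Deck}

/-- Each leaf is the image of the graph of a continuous function under the covering map. -/
lemma leaf_eq_range (h : IsGeneratedBy T a b) {x : Plane} {φ : ℝ → ℝ} (hφ : Continuous φ)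
    (hlev : ∀ w z, definingFunction T ρ (planePoint a b w z) = definingFunction T ρ x ↔ z = φ w) :
    (fun y => cover (T.chart y)) ''
        connectedComponentIn {y | definingFunction T ρ y = definingFunction T ρ x} x =
      range fun w => cover (T.chart (planePoint a b w (φ w))) := by
  have hrange : {y | definingFunction T ρ y = definingFunction T ρ x} =
      range fun w => planePoint a b w (φ w) := by
    ext y
    constructor
    · intro hy
      obtain ⟨w, z, rfl⟩ := h.planePoint_surjective y
      rw [mem_ofPred_eq, hlev] at hy
      exact ⟨w, by rw [hy]⟩
    · rintro ⟨w, rfl⟩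
      exact (hlev w _).2 rfl
  have hcont : Continuous fun w => planePoint a b w (φ w) :=
    (planePoint_continuous a b).comp (continuous_id.prodMk hφ)
  rw [IsPreconnected.connectedComponentIn (hrange ▸ isPreconnected_range hcont)
    (by rw [mem_ofPred_eq]), hrange, ← range_comp]
  rfl

lemma continuous_leaf (T : OneVertexTriangulation) (a b : Deck) {φ : ℝ → ℝ} (hφ : Continuous φ) :
    Continuous fun w => cover (T.chart (planePoint a b w (φ w))) :=
  continuous_cover.comp (T.chart.continuous.comp
    ((planePoint_continuous a b).comp (continuous_id.prodMk hφ)))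

/-- Points with the same image differ by a deck transformation; between points of one level it must
fix that level. In the basis `a, a + b` it shifts the parameter `w` by its first coordinate. -/
lemma leaf_eq_leaf_iff (h : IsGeneratedBy T a b) (hρ : IsAllowedAction ρ) {c : ℝ} {φ : ℝ → ℝ}
    (hlev : ∀ w z, definingFunction T ρ (planePoint a b w z) = c ↔ z = φ w) (w w' : ℝ) :
    cover (T.chart (planePoint a b w (φ w))) = cover (T.chart (planePoint a b w' (φ w'))) ↔
      ∃ m n : ℤ, ρ (m • a + n • (a + b)) c = c ∧ w = w' + m := by
  rw [cover_chart_eq_iff]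
  constructor
  · rintro ⟨g, hg⟩
    obtain ⟨m, n, rfl⟩ := h.generate g
    have e : m • a + n • b = (m - n) • a + n • (a + b) := by
      rw [sub_smul, smul_add]
      abel
    refine ⟨m - n, n, ?_, ?_⟩
    · have h1 := h.definingFunction_add hρ (planePoint a b w' (φ w')) (m • a + n • b)
      rw [← hg, (hlev w _).2 rfl, (hlev w' _).2 rfl] at h1
      rw [← e, ← h1]
    · rw [e, ← planePoint_add] at hg
      exact (h.planePoint_injective hg).1
  · rintro ⟨m, n, hfix, rfl⟩
    refine ⟨m • a + n • (a + b), ?_⟩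
    have h1 := h.definingFunction_add hρ (planePoint a b w' (φ w')) (m • a + n • (a + b))
    rw [(hlev w' _).2 rfl, hfix, ← planePoint_add, hlev] at h1
    rw [← planePoint_add, h1]

theorem not_hasClosedLeaf_of_archimedean [Archimedean Deck] (h : IsGeneratedBy T a b)
    (hρ : IsAllowedAction ρ) : ¬ HasClosedLeaf T ρ := by
  rintro ⟨L, ⟨x, hL⟩, ⟨e⟩⟩
  obtain ⟨g₀, g₁, h0, h1⟩ := h.definingFunction_bounded hρ x
  obtain ⟨φ, hφ, hlev⟩ := h.exists_level_graph hρ h0 h1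
  rw [h.leaf_eq_range hφ hlev] at hL
  subst hL
  refine not_bijective_circle (f := fun w => e ⟨_, mem_range_self w⟩)
    (e.continuous.comp ((continuous_leaf T a b hφ).subtype_mk _)) ⟨?_, ?_⟩
  · intro w w' hw
    have hw' := congrArg Subtype.val (e.injective hw)
    obtain ⟨m, n, hfix, rfl⟩ := (h.leaf_eq_leaf_iff hρ hlev w w').1 hw'
    have h2 := hρ.eq_zero_of_fixed_of_archimedean h0 h1 hfix
    have h3 := h.planePoint_injective (w := m) (z := n) (w' := 0) (z' := 0) (by
      have := congrArg pt h2
      rw [pt_add (m • a), pt_zsmul, pt_zsmul, pt_zero] at this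
      simpa [planePoint] using this)
    simp [h3.1]
  · intro y
    obtain ⟨⟨_, w, rfl⟩, rfl⟩ := e.surjective y
    exact ⟨w, rfl⟩

theorem hasClosedLeaf_of_not_archimedean (h : IsGeneratedBy T a b) (hρ : IsAllowedAction ρ)
    (hA : ¬ Archimedean Deck) : HasClosedLeaf T ρ := by
  obtain ⟨k, c, g₀, g₁, hk0, hk, h0, h1⟩ := hρ.exists_fixed_of_not_archimedean hA
  obtain ⟨φ, hφ, hlev⟩ := h.exists_level_graph hρ h0 h1
  -- An element of the stabiliser maps the graph to itself, so it carries the point over `0` to the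
  -- point over `m`.
  have hfix : ∀ m n : ℤ, ρ (m • a + n • (a + b)) c = c → φ m = φ 0 + n := by
    intro m n hmn
    have h2 := h.definingFunction_add hρ (planePoint a b 0 (φ 0)) (m • a + n • (a + b))
    rw [(hlev 0 _).2 rfl, hmn, ← planePoint_add, hlev, zero_add] at h2
    exact h2.symm
  -- The horizontal shifts of the stabiliser of `c`. The projection loses nothing: an element with
  -- `m = 0` gives `φ 0 = φ 0 + n`, hence `n = 0`. So `H` is nontrivial, and its generator is the
  -- period of the leaf up to sign.
  let H : AddSubgroup ℤ :=
    { carrier := {m | ∃ n : ℤ, ρ (m • a + n • (a + b)) c = c}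
      zero_mem' := ⟨0, by rw [zero_smul, zero_smul, add_zero, hρ.map_zero]⟩
      add_mem' := by
        rintro m m' ⟨n, hn⟩ ⟨n', hn'⟩
        refine ⟨n + n', ?_⟩
        rw [add_smul, add_smul, add_add_add_comm, hρ.map_add, hn', hn]
      neg_mem' := by
        rintro m ⟨n, hn⟩
        refine ⟨-n, ?_⟩
        rw [neg_smul, neg_smul, ← neg_add]
        nth_rw 1 [← hn]
        exact hρ.neg_apply _ _ }
  obtain ⟨d, hd⟩ := Int.subgroup_cyclic H
  rw [← AddSubgroup.zmultiples_eq_closure] at hd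
  have hHbot : H ≠ ⊥ := by
    intro hbot
    obtain ⟨m, n, rfl⟩ := h.generate k
    have e : m • a + n • b = (m - n) • a + n • (a + b) := by
      rw [sub_smul, smul_add]
      abel
    rw [e] at hk hk0
    have hmem : m - n ∈ H := ⟨n, hk⟩
    rw [hbot, AddSubgroup.mem_bot] at hmem
    rw [hmem] at hk hk0
    have h2 := hfix 0 n hk
    have hn : n = 0 := by
      have : (n : ℝ) = 0 := by
        push_cast at h2
        linarith
      exact_mod_cast this
    exact hk0 (by simp [hn])
  have hd0 : d ≠ 0 := by
    rintro rfl
    exact hHbot (hd.trans AddSubgroup.zmultiples_zero_eq_bot)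
  set γ : ℝ → Torus := fun w => cover (T.chart (planePoint a b w (φ w))) with hγ
  have hγc : Continuous γ := continuous_leaf T a b hφ
  have hγeq : ∀ w w', γ w = γ w' ↔ ∃ j : ℤ, w = w' + j * d := by
    intro w w'
    refine (h.leaf_eq_leaf_iff hρ hlev w w').trans ⟨?_, ?_⟩
    · rintro ⟨m, n, hmn, rfl⟩
      have hm : m ∈ H := ⟨n, hmn⟩
      rw [hd] at hm
      obtain ⟨j, rfl⟩ := AddSubgroup.mem_zmultiples_iff.1 hm
      exact ⟨j, by simp⟩
    · rintro ⟨j, rfl⟩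
      have hm : j • d ∈ H := by
        rw [hd]
        exact AddSubgroup.zsmul_mem_zmultiples d j
      obtain ⟨n, hn⟩ := hm
      exact ⟨j • d, n, hn, by simp⟩
  have hper : Function.Periodic γ (|d| : ℤ) := by
    intro w
    rw [hγeq]
    rcases abs_choice d with hd' | hd' <;> rw [hd']
    · exact ⟨1, by simp⟩
    · exact ⟨-1, by simp⟩
  have hpos : (0 : ℝ) < (|d| : ℤ) := by exact_mod_cast abs_pos.2 hd0
  have : Fact ((0 : ℝ) < (|d| : ℤ)) := ⟨hpos⟩
  have hlc : Continuous (hper.lift : AddCircle (((|d| : ℤ) : ℝ)) → Torus) :=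
    isQuotientMap_quotient_mk'.continuous_iff.2 hγc
  have hli : Function.Injective (hper.lift : AddCircle (((|d| : ℤ) : ℝ)) → Torus) := by
    intro y y' hy
    obtain ⟨w, rfl⟩ := QuotientAddGroup.mk_surjective y
    obtain ⟨w', rfl⟩ := QuotientAddGroup.mk_surjective y'
    obtain ⟨j, rfl⟩ := (hγeq w w').1 hy
    refine sub_eq_zero.1 ((AddCircle.coe_eq_zero_iff _ (x := w' + j * d - w')).2 ?_)
    rcases abs_choice d with hd' | hd' <;> rw [hd']
    · exact ⟨j, by simp⟩
    · exact ⟨-j, by simp⟩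
  have hrange : range (hper.lift : AddCircle (((|d| : ℤ) : ℝ)) → Torus) = range γ := by
    ext y
    constructor
    · rintro ⟨u, rfl⟩
      obtain ⟨w, rfl⟩ := QuotientAddGroup.mk_surjective u
      exact ⟨w, rfl⟩
    · rintro ⟨w, rfl⟩
      exact ⟨(w : AddCircle (((|d| : ℤ) : ℝ))), rfl⟩
  have hc0 : definingFunction T ρ (planePoint a b 0 (φ 0)) = c := (hlev 0 _).2 rfl
  refine ⟨range γ, ⟨planePoint a b 0 (φ 0), ?_⟩, ⟨?_⟩⟩
  · rw [h.leaf_eq_range hφ (by rw [hc0]; exact hlev)]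
  -- The induced map is a continuous injection from a compact circle to a Hausdorff space, hence an
  -- embedding.
  · rw [← hrange]
    exact (hlc.isClosedEmbedding hli).isEmbedding.toHomeomorph.symm.trans
      (AddCircle.homeomorphCircle hpos.ne')

end IsGeneratedBy

theorem IsAllowedAction.hasClosedLeaf_iff (hρ : IsAllowedAction ρ) (T : OneVertexTriangulation) :
    HasClosedLeaf T ρ ↔ ¬ Archimedean Deck := by
  obtain ⟨a, b, h⟩ := T.exists_isGeneratedBy
  exact ⟨fun hc _ => h.not_hasClosedLeaf_of_archimedean hρ hc, h.hasClosedLeaf_of_not_archimedean hρ⟩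

end Leaves

end FLOiation

theorem mainTheorem5 [LinearOrder Deck] [IsOrderedAddMonoid Deck]
    (T : FLOiation.OneVertexTriangulation) :
    (∀ s : ℕ ≃ Deck, s 0 = 0 →
      (FLOiation.HasClosedLeaf T (FLOiation.extendedAction (FLOiation.minimalEmbedding s)) ↔
        ¬ Archimedean Deck)) ∧
    (∀ ρ : Deck → ℝ → ℝ, FLOiation.IsAllowedAction ρ →
      (FLOiation.HasClosedLeaf T ρ ↔ ¬ Archimedean Deck)) := by
  refine ⟨fun s hs => ?_, fun ρ hρ => hρ.hasClosedLeaf_iff T⟩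
  exact (FLOiation.isAllowedAction_extendedAction_minimalEmbedding s hs).hasClosedLeaf_iff T
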